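/- **Setting.** Let $\mathcal K$ be a field, $<$ a degree-compatible (graded) monomial order on the monomials $T$ of $\mathcal K[x_1,\dots,x_n]$, and $f_1,\dots,f_m$ nonzero homogeneous polynomials. $\mathrm{HM}(p)$ is the head monomial of $p$. A *signature* is $t\mathbf F_i$ with $t\in T$, $1\le i\le m$ (its *index* is $i$); put $t\mathbf F_i\prec s\mathbf F_j$ iff $i>j$, or $i=j$ and $t<s$, and let $u\cdot t\mathbf F_i=(ut)\mathbf F_i$; $t\mathbf F_i$ divides $s\mathbf F_j$ iff $i=j$ and $t\mid s$. A *labeled polynomial* is $r=(\mathcal S(r),\mathrm{poly}(r))$, and $\mathrm{HM}(r)=\mathrm{HM}(\mathrm{poly}(r))$. The S-pair of $r,r'$ has the *parts* $u\,r$ and $u'\,r'$ with $u=\mathrm{lcm}(\mathrm{HM}(r),\mathrm{HM}(r'))/\mathrm{HM}(r)$ and $u'$ defined likewise; its signature is the greater of $u\,\mathcal S(r)$, $u'\,\mathcal S(r')$. **The F5 algorithm.** The labeled polynomials are stored in an array $R=(r_1,r_2,\dots)$, where $r_i=(\mathbf F_i,f_i/\mathrm{HC}(f_i))$ for $i\le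 m$ ($\mathrm{HC}$ is the head coefficient); whenever a new labeled polynomial is computed it is appended to $R$, and a rule (its signature monomial and position) is put in front of the list $Rule[\text{index}]$. `Rewritten?`$(u,r_k)$ is true iff the newest rule of the index of $r_k$ whose monomial divides that of $u\,\mathcal S(r_k)$ exists and is not the rule of $r_k$. Start with $G_m=\{r_m\}$; for $i=m-1,\dots,1$ call `AlgorithmF5`, which computes $G_i$ from $G_{i+1}$; in it $\varphi=\varphi_{i+1}$ takes a normal form with respect to $G_{i+1}$: * $G_i:=G_{i+1}\cup\{r_i\}$ and $P:=\{\texttt{CritPair}(r_i,r): r\in G_{i+1}\}$. `CritPair` discards an S-pair if a part $u\,r$ with $r$ of index $i$, $\mathcal S(r)=t\mathbf F_i$, has $\varphi(ut)\ne ut$ (*normal form check*). * While $P\neq\emptyset$: remove from $P$ the pairs whose lcm has minimal degree. `Spol`, one pair at a time, discards a pair if `Rewritten?` is true for one of its parts, and otherwise appends to $R$ the S-polynomial (greater-signature part minus the other part, with the signature of the pair) and puts it into $ToDo$. Then, with $Done:=\emptyset$, `Reduction` runs until $ToDo=\emptyset$: choose $h\in ToDo$ of minimal signature and replace $\mathrm{poly}(h)$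 by $\varphi(\mathrm{poly}(h))$. If it is $0$, drop $h$. Otherwise `IsReducible` goes through $r\in G_i\cup Done$ in some order and returns the first $r$ such that, with $u=\mathrm{HM}(h)/\mathrm{HM}(r)$ and $\mathcal S(r)=t\mathbf F_j$: (a) $u\in T$; (b) $\varphi(ut)=ut$; (c) `Rewritten?`$(u,r)$ is false; (d) $u\,\mathcal S(r)\ne\mathcal S(h)$. If there is none, $h$ is made monic and moved from $ToDo$ to $Done$. If $u\,\mathcal S(r)\prec\mathcal S(h)$, $h$ is top-reduced by $r$ and stays in $ToDo$. Otherwise the S-polynomial of $u\,r$ and $1\cdot h$, with signature $u\,\mathcal S(r)$, is appended to $R$ and to $ToDo$, and $h$ stays in $ToDo$. Finally each $r\in Done$ in turn is moved to $G_i$, after adding to $P$ the pairs $\texttt{CritPair}(r,r')$, $r'\in G_i$. Choices not specified above (orders of traversal, choice of normal forms) are arbitrary. A *processing attempt* of an S-pair ends when one of its parts is rejected by the normal form check (in `CritPair`, or as check (b) of `IsReducible` for the parts $u\,r$, $1\cdot h$), or by `Rewritten?` (in `Spol`, or as check (c)), or when its S-polynomial is computed (in `Spol`, or after `IsReducible`).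 **Theorem.** Consider any moment of the run, in the call with $i=1$, just before a labeled polynomial $g$ is added to $Done$, and let $G_g=G_1\cup Done$ at that moment. Then every S-pair of two distinct elements of $G_g$ whose signature is $\prec\mathcal S(g)$ has been processed, and its first processing attempt had one of the following outcomes: 1. a part $s\,r$ was rejected by the normal form check; this part satisfies the *F5 criterion*: $\varphi_{j+1}(st)\neq st$, where $\mathcal S(r)=t\mathbf F_j$ and $\varphi_{j+1}$ is the normal form with respect to $G_{j+1}$, the elements of $G_g$ of index $>j$; 2. a part $s\,r_k$ was rejected by `Rewritten?`; this part satisfies the *Rewritten criterion*: there is $l>k$ such that $\mathcal S(r_l)$ divides $s\,\mathcal S(r_k)$; 3. no part was rejected and the S-polynomial was computed, as some $r_l$ whose signature is that of the S-pair. It has been reduced by elements of $G_g$ to a polynomial $q$, with every step signature-safe (each subtracted multiple $t\,b$, $b\in G_g$, has $t\,\mathcal S(b)\prec\mathcal S(r_l)$), and $\mathrm{poly}(r_l)$ is $q$ up to a nonzero constant factor. If $q\neq0$, then $r_l\in G_g$. If $q=0$, nothing is stored, and the part of greater signature satisfies the Rewritten criterion. -/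

import Mathlib

/-! The F5 algorithm on a list of homogeneous polynomials `f₁, …, f_m`, as a (nondeterministic)
small-step machine.  Indices of signatures run through `1, …, m`, positions in the array `R` of
labeled polynomials start at `1`, and the positions `1, …, m` hold the input polynomials.  Every
choice which the algorithm leaves open (the order in which sets are traversed, the choice of a
normal form) is a nondeterministic choice of the machine. -/

namespace F5

open MvPolynomial

/-- Monomials in `n` variables, as exponent vectors: the product is `+`, divisibility is `≤`,
the least common multiple is `⊔`, and exact division is `-`. -/
abbrev Mon (n : ℕ) : Type := Fin n →₀ ℕ

/-- A monomial order is graded (degree compatible) if smaller total degree means smaller. -/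
def IsGraded {n : ℕ} (mo : MonomialOrder (Fin n)) : Prop :=
  ∀ a b : Mon n, a.degree < b.degree → mo.toSyn a < mo.toSyn b

/-- The signature `t F_i`. -/
structure Sig (n : ℕ) where
  mono : Mon n
  index : ℕ

namespace Sig

variable {n : ℕ}

/-- `u · (t F_i) = (u t) F_i`. -/
noncomputable def mul (u : Mon n) (s : Sig n) : Sig n := ⟨u + s.mono, s.index⟩

/-- Divisibility of signatures. -/
def Divides (s t : Sig n) : Prop := s.index = t.index ∧ s.mono ≤ t.mono

/-- The signature order: `t F_i ≺ s F_j` iff `i > j`, or `i = j` and `t < s`. -/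
def Lt (mo : MonomialOrder (Fin n)) (s t : Sig n) : Prop :=
  t.index < s.index ∨ s.index = t.index ∧ mo.toSyn s.mono < mo.toSyn t.mono

/-- The reflexive signature order. -/
def Le (mo : MonomialOrder (Fin n)) (s t : Sig n) : Prop := Lt mo s t ∨ s = t

end Sig

/-- A labeled polynomial `(S(r), poly(r))`. -/
structure LabeledPoly (n : ℕ) (K : Type*) [Field K] where
  sig : Sig n
  poly : MvPolynomial (Fin n) K

/-- A monomial multiple `u · r` of the labeled polynomial at position `pos`. -/
structure Part (n : ℕ) where
  mult : Mon n
  pos : ℕ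

/-- What a processing attempt of an S-pair ends with: one of its parts is rejected by the normal
form check, or by the check `Rewritten?`, or the S-polynomial is computed and put at position
`l` of `R`. -/
inductive Outcome (n : ℕ) where
  | rejectedNF (p : Part n)
  | rejectedRW (p : Part n)
  | computed (l : ℕ)

/-- A record of a processing attempt: the S-pair (the unordered pair of its parts) and what
happened to it. -/
abbrev LogEntry (n : ℕ) : Type := Sym2 (Part n) × Outcome n

/-- A critical pair `[t, u₁, r₁, u₂, r₂]`, with the part of greater signature first. -/
structure CritPair (n : ℕ) where
  lcm : Mon n
  hi : Part n
  lo : Part n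

/-- The global memory: the array `R` with its length `N`, the arrays of rules (newest rule
first), and the chronological record of the processing attempts, which the algorithm writes but
never reads. -/
structure Mem (n : ℕ) (K : Type*) [Field K] where
  R : ℕ → LabeledPoly n K
  N : ℕ
  Rule : ℕ → List (Mon n × ℕ)
  log : List (LogEntry n)

/-! ### Reduction of polynomials -/

section Reduction

variable {n : ℕ} {K : Type*} [Field K]

/-- Eliminate the term of `p` with monomial `a` by means of the multiple of `b` whose head
monomial is `a`. -/
noncomputable def elim (mo : MonomialOrder (Fin n)) (p b : MvPolynomial (Fin n) K) (a : Mon n) :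
    MvPolynomial (Fin n) K :=
  p - monomial (a - mo.degree b) (coeff a p / mo.leadingCoeff b) * b

/-- One reduction of some term of `p` by an element of `B`. -/
def RedStep (mo : MonomialOrder (Fin n)) (B : Set (MvPolynomial (Fin n) K))
    (p q : MvPolynomial (Fin n) K) : Prop :=
  ∃ b ∈ B, ∃ a ∈ p.support, mo.degree b ≤ a ∧ q = elim mo p b a

/-- `q` is a normal form of `p` with respect to `B`. -/
def IsNormalForm (mo : MonomialOrder (Fin n)) (B : Set (MvPolynomial (Fin n) K))
    (p q : MvPolynomial (Fin n) K) : Prop :=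
  Relation.ReflTransGen (RedStep mo B) p q ∧ ∀ b ∈ B, ∀ a ∈ q.support, ¬ mo.degree b ≤ a

/-- One signature-safe reduction, for a labeled polynomial with signature `s`, of some term of
`p` by an element `r` of `B`: the multiple `t · r` that is subtracted satisfies
`t · S(r) ≺ s`. -/
def SafeRedStep (mo : MonomialOrder (Fin n)) (B : Set (LabeledPoly n K)) (s : Sig n)
    (p q : MvPolynomial (Fin n) K) : Prop :=
  ∃ r ∈ B, ∃ a ∈ p.support, mo.degree r.poly ≤ a ∧
    Sig.Lt mo (Sig.mul (a - mo.degree r.poly) r.sig) s ∧ q = elim mo p r.poly a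

/-- `q` is obtained from `p` by finitely many signature-safe reductions. -/
def SafeReduces (mo : MonomialOrder (Fin n)) (B : Set (LabeledPoly n K)) (s : Sig n)
    (p q : MvPolynomial (Fin n) K) : Prop :=
  Relation.ReflTransGen (SafeRedStep mo B s) p q

/-- Division by the head coefficient. -/
noncomputable def monic (mo : MonomialOrder (Fin n)) (p : MvPolynomial (Fin n) K) :
    MvPolynomial (Fin n) K :=
  C (mo.leadingCoeff p)⁻¹ * p

end Reduction

/-! ### Operations on the memory -/

namespace Mem

variable {n : ℕ} {K : Type*} [Field K]

/-- The head monomial of the labeled polynomial at position `k`. -/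
noncomputable def hm (mo : MonomialOrder (Fin n)) (D : Mem n K) (k : ℕ) : Mon n :=
  mo.degree (D.R k).poly

/-- The labeled polynomials at the positions in `L`. -/
def labeled (D : Mem n K) (L : List ℕ) : Set (LabeledPoly n K) := {r | ∃ k ∈ L, D.R k = r}

/-- The polynomials at the positions in `L`. -/
def polys (D : Mem n K) (L : List ℕ) : Set (MvPolynomial (Fin n) K) :=
  {p | ∃ k ∈ L, (D.R k).poly = p}

/-- The signature `u · S(r)` of a part. -/
noncomputable def partSig (D : Mem n K) (p : Part n) : Sig n := Sig.mul p.mult (D.R p.pos).sig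

/-- The polynomial `u · poly(r)` of a part. -/
noncomputable def partPoly (D : Mem n K) (p : Part n) : MvPolynomial (Fin n) K :=
  monomial p.mult 1 * (D.R p.pos).poly

/-- Change the polynomial at position `k`, keeping the signature. -/
def setPoly (D : Mem n K) (k : ℕ) (p : MvPolynomial (Fin n) K) : Mem n K :=
  { D with R := Function.update D.R k ⟨(D.R k).sig, p⟩ }

/-- Append a labeled polynomial to `R` and add its rule in front of the rules of its index. -/
def append (D : Mem n K) (s : Sig n) (p : MvPolynomial (Fin n) K) : Mem n K :=
  { D with
    R := Function.update D.R (D.N + 1) ⟨s, p⟩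
    N := D.N + 1
    Rule := Function.update D.Rule s.index ((s.mono, D.N + 1) :: D.Rule s.index) }

/-- Record processing attempts. -/
def record (D : Mem n K) (es : List (LogEntry n)) : Mem n K := { D with log := D.log ++ es }

open Classical in
/-- `Rewritten?(u, r_k)`: the newest rule whose signature divides `u · S(r_k)` exists and does
not belong to `r_k` itself. -/
def Rewritten (D : Mem n K) (p : Part n) : Prop :=
  ∃ e, (D.Rule (D.R p.pos).sig.index).find? (fun e => decide (e.1 ≤ (D.partSig p).mono)) = some e ∧
    e.2 ≠ p.pos

/-- The normal form check fails: `φ(u t) ≠ u t`, where `t F_i` is the signature of the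
polynomial at `pos`, and `φ` is the normal form with respect to the polynomials in `L`. -/
def NFCheckFails (mo : MonomialOrder (Fin n)) (D : Mem n K) (L : List ℕ) (p : Part n) : Prop :=
  ¬ IsNormalForm mo (D.polys L) (monomial (D.partSig p).mono 1) (monomial (D.partSig p).mono 1)

/-- The part belonging to `r_a` of the S-pair of `r_a` and `r_b`. -/
noncomputable def spairPart (mo : MonomialOrder (Fin n)) (D : Mem n K) (a b : ℕ) : Part n :=
  ⟨D.hm mo a ⊔ D.hm mo b - D.hm mo a, a⟩

open Classical in
/-- `CritPair(r_a, r_b, i, φ)`, where `φ` is the normal form with respect to `Gprev = G_{i+1}`: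
the critical pair, unless it is discarded. -/
noncomputable def critPair (mo : MonomialOrder (Fin n)) (D : Mem n K) (Gprev : List ℕ) (i a b : ℕ) :
    List (LogEntry n) × List (CritPair n) :=
  let pa := D.spairPart mo a b
  let pb := D.spairPart mo b a
  let hi := if Sig.Lt mo (D.partSig pa) (D.partSig pb) then pb else pa
  let lo := if Sig.Lt mo (D.partSig pa) (D.partSig pb) then pa else pb
  if i < (D.partSig hi).index then ([], [])
  else if D.NFCheckFails mo Gprev hi then ([(s(hi, lo), .rejectedNF hi)], [])
  else if (D.partSig lo).index = i ∧ D.NFCheckFails mo Gprev lo then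
    ([(s(hi, lo), .rejectedNF lo)], [])
  else ([], [⟨D.hm mo a ⊔ D.hm mo b, hi, lo⟩])

/-- The critical pairs of `r_a` with all `r_b`, `b ∈ L`. -/
noncomputable def critPairs (mo : MonomialOrder (Fin n)) (D : Mem n K) (Gprev : List ℕ) (i a : ℕ)
    (L : List ℕ) : List (LogEntry n) × List (CritPair n) :=
  (L.flatMap fun b => (D.critPair mo Gprev i a b).1, L.flatMap fun b => (D.critPair mo Gprev i a b).2)

open Classical in
/-- The body of the loop of `Spol`, for one critical pair: the new memory, and the position of
the new S-polynomial if there is one. -/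
noncomputable def spol (D : Mem n K) (p : CritPair n) : Mem n K × List ℕ :=
  if D.Rewritten p.hi then (D.record [(s(p.hi, p.lo), .rejectedRW p.hi)], [])
  else if D.Rewritten p.lo then (D.record [(s(p.hi, p.lo), .rejectedRW p.lo)], [])
  else
    ((D.append (D.partSig p.hi) (D.partPoly p.hi - D.partPoly p.lo)).record
      [(s(p.hi, p.lo), .computed (D.N + 1))], [D.N + 1])

open Classical in
/-- `IsReducible` for `r_k`: go through the list of candidate reductors and return the first one
that passes the checks (a) - (d), together with the record of the rejections by (b) and (c).
A candidate `r_j` with multiplier `u` makes up an S-pair with parts `u · r_j` and `1 · r_k`. -/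
noncomputable def isReducible (mo : MonomialOrder (Fin n)) (D : Mem n K) (Gprev : List ℕ) (k : ℕ) :
    List ℕ → List (LogEntry n) × Option ℕ
  | [] => ([], none)
  | j :: L =>
    let rest := isReducible mo D Gprev k L
    let pj : Part n := ⟨D.hm mo k - D.hm mo j, j⟩
    let pr : Sym2 (Part n) := s(pj, ⟨0, k⟩)
    if ¬ D.hm mo j ≤ D.hm mo k then rest
    else if D.NFCheckFails mo Gprev pj then ((pr, .rejectedNF pj) :: rest.1, rest.2)
    else if D.Rewritten pj then ((pr, .rejectedRW pj) :: rest.1, rest.2)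
    else if D.partSig pj = (D.R k).sig then rest
    else ([], some j)

end Mem

/-! ### The machine -/

/-- The local variables of a call of `AlgorithmF5`: the index `i` of the input polynomial, the
result `Gprev = G_{i+1}` of the previous call, the current `G = G_i`, and the critical pairs. -/
structure Call (n : ℕ) where
  i : ℕ
  Gprev : List ℕ
  G : List ℕ
  P : List (CritPair n)

/-- The control part of a state. -/
inductive Phase (n : ℕ) where
  /-- `G_i` has been computed. -/
  | finished (i : ℕ) (G : List ℕ)
  /-- At the head of the `while` loop of `AlgorithmF5`. -/
  | loop (c : Call n)
  /-- In `Spol`: the critical pairs still to be treated, and the result `F` so far. -/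
  | spol (c : Call n) (Pd : List (CritPair n)) (F : List ℕ)
  /-- At the head of the `while` loop of `Reduction`. -/
  | reduction (c : Call n) (ToDo Done : List ℕ)
  /-- In the `for` loop of `AlgorithmF5` over `R_d`: the elements still to be treated. -/
  | collect (c : Call n) (Rd : List ℕ)

/-- A state of the machine. -/
structure State (n : ℕ) (K : Type*) [Field K] where
  mem : Mem n K
  phase : Phase n

section Machine

variable {n : ℕ} {K : Type*} [Field K]

/-- `Reduction` takes `r_k` out of `ToDo`, having minimal signature there, and its normal form
with respect to `G_{i+1}` is `p`. -/
def Selects (mo : MonomialOrder (Fin n)) (D : Mem n K) (c : Call n) (ToDo : List ℕ) (k : ℕ)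
    (p : MvPolynomial (Fin n) K) : Prop :=
  k ∈ ToDo ∧ (∀ j ∈ ToDo, Sig.Le mo (D.R k).sig (D.R j).sig) ∧
    IsNormalForm mo (D.polys c.Gprev) (D.R k).poly p

/-- The step of `Reduction` which adds `r_k` to `Done`: its normal form `p` is not zero, and
`IsReducible` finds no reductor in `G ∪ Done`. -/
inductive AddsToDone (mo : MonomialOrder (Fin n)) : State n K → ℕ → State n K → Prop where
  | mk (D : Mem n K) (c : Call n) (ToDo Done : List ℕ) (k : ℕ) (p : MvPolynomial (Fin n) K)
      (L : List ℕ) (es : List (LogEntry n)) :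
      Selects mo D c ToDo k p → p ≠ 0 → L.Perm (c.G ++ Done) →
      (D.setPoly k p).isReducible mo c.Gprev k L = (es, none) →
      AddsToDone mo ⟨D, .reduction c ToDo Done⟩ k
        ⟨(D.setPoly k (monic mo p)).record es, .reduction c (ToDo.erase k) (Done ++ [k])⟩

/-- The steps of the algorithm. -/
inductive Step (mo : MonomialOrder (Fin n)) : State n K → State n K → Prop where
  /-- `incrementalF5` calls `AlgorithmF5` for the next input polynomial `f_i`. -/
  | call (D : Mem n K) (i : ℕ) (G : List ℕ) : 1 ≤ i →
      Step mo ⟨D, .finished (i + 1) G⟩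
        ⟨D.record (D.critPairs mo G i i G).1,
          .loop ⟨i, G, G ++ [i], (D.critPairs mo G i i G).2⟩⟩
  /-- `AlgorithmF5` returns when there are no critical pairs left. -/
  | ret (D : Mem n K) (c : Call n) : c.P = [] →
      Step mo ⟨D, .loop c⟩ ⟨D, .finished c.i c.G⟩
  /-- The critical pairs of minimal total degree `d` are selected and passed to `Spol`. -/
  | select (D : Mem n K) (c : Call n) (d : ℕ) :
      (∃ p ∈ c.P, p.lcm.degree = d) → (∀ p ∈ c.P, d ≤ p.lcm.degree) →
      Step mo ⟨D, .loop c⟩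
        ⟨D, .spol { c with P := c.P.filter fun p => p.lcm.degree ≠ d }
          (c.P.filter fun p => p.lcm.degree = d) []⟩
  /-- `Spol` treats one of the critical pairs. -/
  | spol (D : Mem n K) (c : Call n) (P₁ P₂ : List (CritPair n)) (p : CritPair n) (F : List ℕ) :
      Step mo ⟨D, .spol c (P₁ ++ p :: P₂) F⟩
        ⟨(D.spol p).1, .spol c (P₁ ++ P₂) (F ++ (D.spol p).2)⟩
  /-- `Spol` returns `F`, and `Reduction` is called with `ToDo = F`. -/
  | reduce (D : Mem n K) (c : Call n) (F : List ℕ) :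
      Step mo ⟨D, .spol c [] F⟩ ⟨D, .reduction c F []⟩
  /-- `TopReduction` drops a polynomial which has become zero. -/
  | zero (D : Mem n K) (c : Call n) (ToDo Done : List ℕ) (k : ℕ) :
      Selects mo D c ToDo k 0 →
      Step mo ⟨D, .reduction c ToDo Done⟩
        ⟨D.setPoly k 0, .reduction c (ToDo.erase k) Done⟩
  /-- No reductor is found: the polynomial is added to `Done`. -/
  | done (s s' : State n K) (k : ℕ) : AddsToDone mo s k s' → Step mo s s'
  /-- The reductor `r_j` that is found is signature-safe: the reduction is performed, and the
  result stays in `ToDo`. -/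
  | safe (D : Mem n K) (c : Call n) (ToDo Done : List ℕ) (k : ℕ) (p : MvPolynomial (Fin n) K)
      (L : List ℕ) (es : List (LogEntry n)) (j : ℕ) :
      Selects mo D c ToDo k p → p ≠ 0 → L.Perm (c.G ++ Done) →
      (D.setPoly k p).isReducible mo c.Gprev k L = (es, some j) →
      Sig.Lt mo (D.partSig ⟨mo.degree p - D.hm mo j, j⟩) (D.R k).sig →
      Step mo ⟨D, .reduction c ToDo Done⟩
        ⟨(D.setPoly k (elim mo p (D.R j).poly (mo.degree p))).record es,
          .reduction c ToDo Done⟩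
  /-- The reductor `r_j` that is found is not signature-safe: a new labeled polynomial, with the
  greater signature, is formed from the S-pair of `r_j` and `r_k`; both stay in `ToDo`. -/
  | fresh (D : Mem n K) (c : Call n) (ToDo Done : List ℕ) (k : ℕ) (p : MvPolynomial (Fin n) K)
      (L : List ℕ) (es : List (LogEntry n)) (j : ℕ) :
      Selects mo D c ToDo k p → p ≠ 0 → L.Perm (c.G ++ Done) →
      (D.setPoly k p).isReducible mo c.Gprev k L = (es, some j) →
      ¬ Sig.Lt mo (D.partSig ⟨mo.degree p - D.hm mo j, j⟩) (D.R k).sig →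
      Step mo ⟨D, .reduction c ToDo Done⟩
        ⟨((D.setPoly k p).append (D.partSig ⟨mo.degree p - D.hm mo j, j⟩)
            (- elim mo p (D.R j).poly (mo.degree p))).record
            (es ++ [(s(⟨mo.degree p - D.hm mo j, j⟩, ⟨0, k⟩), .computed (D.N + 1))]),
          .reduction c (ToDo ++ [D.N + 1]) Done⟩
  /-- `Reduction` returns `R_d = Done` when `ToDo` is empty. -/
  | reduced (D : Mem n K) (c : Call n) (Done : List ℕ) :
      Step mo ⟨D, .reduction c [] Done⟩ ⟨D, .collect c Done⟩
  /-- An element `r_k` of `R_d` is moved to `G_i`, with its new critical pairs. -/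
  | collect (D : Mem n K) (c : Call n) (L₁ L₂ : List ℕ) (k : ℕ) :
      Step mo ⟨D, .collect c (L₁ ++ k :: L₂)⟩
        ⟨D.record (D.critPairs mo c.Gprev c.i k c.G).1,
          .collect { c with
            G := c.G ++ [k]
            P := c.P ++ (D.critPairs mo c.Gprev c.i k c.G).2 } (L₁ ++ L₂)⟩
  /-- Back to the `while` loop of `AlgorithmF5`. -/
  | again (D : Mem n K) (c : Call n) : Step mo ⟨D, .collect c []⟩ ⟨D, .loop c⟩

open Classical in
/-- The initial memory for the input `f₁, …, f_m`: the labeled polynomials `(1 · F_i, f_i)`, with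
`f_i` made monic, at the positions `1, …, m`, and no rules. -/
noncomputable def initMem (mo : MonomialOrder (Fin n)) {m : ℕ}
    (f : Fin m → MvPolynomial (Fin n) K) : Mem n K where
  R := fun k => ⟨⟨0, k⟩, if h : 1 ≤ k ∧ k ≤ m then monic mo (f ⟨k - 1, by omega⟩) else 0⟩
  N := m
  Rule := fun _ => []
  log := []

/-- The states which the algorithm reaches on the input `f₁, …, f_m`; it starts with
`G_m = {r_m}`. -/
def Reachable (mo : MonomialOrder (Fin n)) {m : ℕ} (f : Fin m → MvPolynomial (Fin n) K)
    (s : State n K) : Prop :=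
  1 ≤ m ∧ Relation.ReflTransGen (Step mo) ⟨initMem mo f, .finished m [m]⟩ s

end Machine

/-! ### The criteria, and the result of processing an S-pair -/

section Criteria

variable {n : ℕ} {K : Type*} [Field K]

open Classical in
/-- The multiple `u · r` satisfies the F5 criterion, relative to the set `Gg` of positions:
`φ(u S(r)) ≠ u S(r)`, where `φ` is the normal form with respect to `G_{index(r)+1}`, the elements
of `Gg` with index greater than that of `r`. -/
def SatisfiesF5 (mo : MonomialOrder (Fin n)) (D : Mem n K) (Gg : List ℕ) (p : Part n) : Prop :=
  D.NFCheckFails mo (Gg.filter fun k => (D.R p.pos).sig.index < (D.R k).sig.index) p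

/-- The multiple `u · r_i` satisfies the Rewritten criterion: the signature of some `r_j` with
`j > i` divides `u · S(r_i)`. -/
def SatisfiesRewritten (D : Mem n K) (p : Part n) : Prop :=
  ∃ j, p.pos < j ∧ j ≤ D.N ∧ Sig.Divides (D.R j).sig (D.partSig p)

/-- `o` is what the first processing attempt of the S-pair `pr` ended with. -/
def FirstOutcome (D : Mem n K) (pr : Sym2 (Part n)) (o : Outcome n) : Prop :=
  ∃ l₁ l₂, D.log = l₁ ++ (pr, o) :: l₂ ∧ ∀ e ∈ l₁, e.1 ≠ pr

end Criteria

end F5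

/-! The theorem is read off an invariant `Inv` of the machine, with one clause per phase, which
every step preserves (`Step.inv`). Two things have to follow from it: the S-pair has some record in
the log, and every record is true of the current memory. The second then holds for the first record
in particular.

Existence of a record rests on homogeneity: a polynomial with signature `t F_i` has degree `deg t +
deg f_i`, so the signature of either part of an S-pair determines the degree of the lcm
(`Config.weight_spairPart`). During `Reduction` everything in `ToDo` and `Done` has one weight `d`,
while the pairs left in `P` have degree above `d`. For an S-pair of the current index with signature
below that of `g`, gradedness bounds the degree of the lcm by `d`. If both elements lie in `G`, the
pair has thus left `P` and is logged. If one lies in `Done`, the degree is exactly `d` and the lcm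
is the head monomial of that element. When the last of the `Done` elements of the pair was added,
`IsReducible` examined the other element as a candidate; a candidate whose head divides can only
escape the log through check (d). This cannot happen: an element of `G` has an earlier position, so
the rule of `h` already triggers check (c), and an element of `Done` has the same degree, hence
multiplier 1, but a strictly smaller signature (`RedInv.logged_of_isReducible`). Pairs of larger
index were logged in earlier calls. `RedInv.logged_of_lt` combines these cases.

Truth of the records is clear for rejections, since signatures and stored elements never change
(`EntryOK.imp`). The delicate case is an S-polynomial formed in `IsReducible` from a polynomial `h`
that stays in `ToDo` and may be reduced afterwards. At that moment `h` is irreducible modulo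
`Gprev`, so later normal forms leave it alone; any other change, apart from scaling, lowers its head
monomial or makes it zero. In the first case the recorded multiples no longer have equal heads and
so are not the parts of a current S-pair; in the second `h` is never stored. Hence a record that
matches two stored elements describes their current S-polynomial (`ComputedOK`,
`Config.setPoly_reduces`, `ComputedOK.reduced`).

Finally, a computed `r_l` is stored, zero, or still in `ToDo`; the last contradicts the minimality
of the signature of `g`. As `r_l` comes after the greater part and carries the signature of the
pair, it is itself the witness for the Rewritten criterion. -/

namespace F5

open MvPolynomial

/-! ### Signatures -/

namespace Sig

variable {n : ℕ} {mo : MonomialOrder (Fin n)} {s t r : Sig n}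

theorem Lt.trans (h₁ : Lt mo s t) (h₂ : Lt mo t r) : Lt mo s r := by
  rcases h₁ with h₁ | ⟨h₁, h₁'⟩ <;> rcases h₂ with h₂ | ⟨h₂, h₂'⟩
  · exact .inl (h₂.trans h₁)
  · exact .inl (h₂ ▸ h₁)
  · exact .inl (h₁ ▸ h₂)
  · exact .inr ⟨h₁.trans h₂, h₁'.trans h₂'⟩

theorem lt_irrefl (s : Sig n) : ¬ Lt mo s s := by
  rintro (h | ⟨-, h⟩)
  · exact absurd h (_root_.lt_irrefl _)
  · exact absurd h (_root_.lt_irrefl _)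

theorem le_of_not_lt (h : ¬ Lt mo s t) : Le mo t s := by
  unfold Lt at h
  push Not at h
  rcases lt_or_eq_of_le h.1 with h' | h'
  · exact .inl (.inl h')
  · rcases lt_or_eq_of_le (h.2 h') with h'' | h''
    · exact .inl (.inr ⟨h'.symm, h''⟩)
    · right
      cases s; cases t
      simp only [Sig.mk.injEq] at *
      exact ⟨mo.toSyn.injective h'', h'.symm⟩

theorem Le.eq_of_le (h₁ : Le mo s t) (h₂ : Le mo t s) : s = t := by
  rcases h₁ with h₁ | h₁
  · rcases h₂ with h₂ | h₂
    · exact absurd (h₁.trans h₂) (lt_irrefl s)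
    · exact h₂.symm
  · exact h₁

theorem Le.index_le (h : Le mo s t) : t.index ≤ s.index := by
  rcases h with (h | h) | h
  · exact h.le
  · exact h.1.ge
  · exact h ▸ le_rfl

theorem mul_zero_left (s : Sig n) : Sig.mul 0 s = s := by simp [Sig.mul]

/-- The degree of the polynomials with signature `s`, when `δ i` is the degree of `f_i`. -/
noncomputable def weight (δ : ℕ → ℕ) (s : Sig n) : ℕ := s.mono.degree + δ s.index

theorem weight_mul (δ : ℕ → ℕ) (u : Mon n) (s : Sig n) :
    (Sig.mul u s).weight δ = u.degree + s.weight δ := by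
  simp [weight, mul, map_add, add_assoc]

/-- This is where gradedness enters: for equal indices, a larger weight means a monomial of larger
degree, hence a larger signature. -/
theorem weight_le_of_lt (hmo : IsGraded mo) (δ : ℕ → ℕ) (h : Lt mo s t) (hi : s.index = t.index) :
    s.weight δ ≤ t.weight δ := by
  rcases h with h | ⟨-, h⟩
  · exact absurd h (by omega)
  · unfold weight
    rw [hi]
    by_contra! hlt
    exact absurd (h.trans (hmo _ _ (by omega : t.mono.degree < s.mono.degree))) (_root_.lt_irrefl _)

end Sig

/-! ### Reduction -/

section Reduction

variable {n : ℕ} {K : Type*} [Field K] {mo : MonomialOrder (Fin n)}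

theorem homogeneous_degree {p : MvPolynomial (Fin n) K} {d : ℕ} (hp : p.IsHomogeneous d)
    {a : Mon n} (ha : a ∈ p.support) : a.degree = d := by
  by_contra h
  exact (mem_support_iff.mp ha) (hp.coeff_eq_zero h)

theorem homogeneous_degree_head {p : MvPolynomial (Fin n) K} {d : ℕ} (hp : p.IsHomogeneous d)
    (h0 : p ≠ 0) : (mo.degree p).degree = d :=
  homogeneous_degree hp (mo.degree_mem_support h0)

/-- Divisibility between monomials of the same degree is equality. -/
theorem mon_eq_of_le_of_degree_le {a b : Mon n} (h : a ≤ b) (hd : b.degree ≤ a.degree) : a = b := by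
  have hs : b - a + a = b := tsub_add_cancel_of_le h
  have h2 : (b - a).degree + a.degree = b.degree := by rw [← map_add, hs]
  have h3 : (b - a).degree = 0 := by omega
  rw [Finsupp.degree_eq_zero_iff] at h3
  rw [← hs, h3, zero_add]

theorem elim_homogeneous {p b : MvPolynomial (Fin n) K} {a : Mon n} {d e : ℕ}
    (hp : p.IsHomogeneous d) (hb : b.IsHomogeneous e) (hb0 : b ≠ 0) (ha : a ∈ p.support)
    (hab : mo.degree b ≤ a) : (elim mo p b a).IsHomogeneous d := by
  refine hp.sub ?_
  have h1 := homogeneous_degree hp ha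
  have h2 := homogeneous_degree_head (mo := mo) hb hb0
  have h3 : (a - mo.degree b).degree + e = d := by
    rw [← h1, ← h2, ← map_add, tsub_add_cancel_of_le hab]
  rw [← h3]
  exact (isHomogeneous_monomial _ rfl).mul hb

theorem degree_elim_le {p b : MvPolynomial (Fin n) K} {a : Mon n} (ha : a ∈ p.support)
    (hab : mo.degree b ≤ a) :
    mo.toSyn (mo.degree (elim mo p b a)) ≤ mo.toSyn (mo.degree p) := by
  refine mo.degree_sub_le.trans (sup_le le_rfl ?_)
  refine mo.degree_mul_le.trans ?_
  rw [map_add]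
  refine (add_le_add_left (mo.degree_monomial_le _) _).trans ?_
  rw [← map_add, tsub_add_cancel_of_le hab]
  exact mo.le_degree ha

/-- The head terms cancel and nothing larger is introduced. Zero is a separate case because
`mo.degree 0 = 0` is not smaller than the head monomial of a constant. -/
theorem degree_elim_head {p b : MvPolynomial (Fin n) K} (hb : b ≠ 0)
    (hab : mo.degree b ≤ mo.degree p) (hp : p ≠ 0) :
    elim mo p b (mo.degree p) = 0 ∨
      mo.toSyn (mo.degree (elim mo p b (mo.degree p))) < mo.toSyn (mo.degree p) := by
  by_cases h0 : elim mo p b (mo.degree p) = 0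
  · exact .inl h0
  refine .inr (lt_of_le_of_ne (degree_elim_le (mo.degree_mem_support hp) hab) fun h => ?_)
  have hd := mo.toSyn.injective h
  have hc : coeff (mo.degree (elim mo p b (mo.degree p))) (elim mo p b (mo.degree p)) ≠ 0 :=
    mo.coeff_degree_ne_zero_iff.mpr h0
  rw [hd] at hc
  apply hc
  have hlb : mo.leadingCoeff b ≠ 0 := mo.leadingCoeff_ne_zero_iff.mpr hb
  have h1 : coeff (mo.degree p) (monomial (mo.degree p - mo.degree b)
      (coeff (mo.degree p) p / mo.leadingCoeff b) * b)
      = (coeff (mo.degree p) p / mo.leadingCoeff b) * mo.leadingCoeff b := by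
    have h2 := coeff_monomial_mul (mo.degree b) (mo.degree p - mo.degree b)
      (coeff (mo.degree p) p / mo.leadingCoeff b) b
    rwa [tsub_add_cancel_of_le hab] at h2
  rw [elim, coeff_sub, h1, div_mul_cancel₀ _ hlb, sub_self]

theorem elim_C_mul (c : K) (p b : MvPolynomial (Fin n) K) (a : Mon n) :
    elim mo (C c * p) b a = C c * elim mo p b a := by
  rw [elim, elim, mul_sub, coeff_C_mul, mul_div_assoc, ← mul_assoc, C_mul_monomial]

/-- No term of `p` is divisible by the head monomial of an element of `B`. -/
def TermsIrreducible (mo : MonomialOrder (Fin n)) (B : Set (MvPolynomial (Fin n) K))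
    (p : MvPolynomial (Fin n) K) : Prop :=
  ∀ b ∈ B, ∀ a ∈ p.support, ¬ mo.degree b ≤ a

/-- An irreducible polynomial admits no first reduction step. This is what makes repeated normal
forms harmless for the records of S-polynomials. -/
theorem TermsIrreducible.eq_of_reduces {B : Set (MvPolynomial (Fin n) K)}
    {p q : MvPolynomial (Fin n) K} (hp : TermsIrreducible mo B p)
    (h : Relation.ReflTransGen (RedStep mo B) p q) : q = p := by
  rcases Relation.ReflTransGen.cases_head h with h | ⟨r, ⟨b, hb, a, ha, hba, -⟩, -⟩
  · exact h.symm
  · exact absurd hba (hp b hb a ha)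

theorem support_C_mul {c : K} (hc : c ≠ 0) (p : MvPolynomial (Fin n) K) :
    (C c * p).support = p.support := by
  ext a
  simp [mem_support_iff, coeff_C_mul, hc]

theorem leadingCoeff_monic {p : MvPolynomial (Fin n) K} (hp : p ≠ 0) :
    mo.leadingCoeff (monic mo p) = 1 := by
  have h : mo.leadingCoeff p ≠ 0 := mo.leadingCoeff_ne_zero_iff.mpr hp
  have hC : (C (mo.leadingCoeff p)⁻¹ : MvPolynomial (Fin n) K) ≠ 0 := by simpa using h
  rw [monic, mo.leadingCoeff_mul_of_mul_leadingCoeff_ne_zero, mo.leadingCoeff_C,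
    inv_mul_cancel₀ h]
  rw [mo.leadingCoeff_C, inv_mul_cancel₀ h]
  exact one_ne_zero

theorem degree_C_mul {c : K} (hc : c ≠ 0) (p : MvPolynomial (Fin n) K) :
    mo.degree (C c * p) = mo.degree p := by
  rcases eq_or_ne p 0 with rfl | hp
  · simp
  · rw [mo.degree_mul (by simpa using hc) hp, mo.degree_C, zero_add]

theorem leadingCoeff_C_mul {c : K} (hc : c ≠ 0) (p : MvPolynomial (Fin n) K) :
    mo.leadingCoeff (C c * p) = c * mo.leadingCoeff p := by
  rw [MonomialOrder.leadingCoeff, degree_C_mul hc, coeff_C_mul, MonomialOrder.leadingCoeff]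

theorem SafeRedStep.C_mul {B : Set (LabeledPoly n K)} {s : Sig n} {p q : MvPolynomial (Fin n) K}
    (h : SafeRedStep mo B s p q) {c : K} (hc : c ≠ 0) :
    SafeRedStep mo B s (C c * p) (C c * q) := by
  obtain ⟨r, hr, a, ha, hra, hs, rfl⟩ := h
  exact ⟨r, hr, a, by rwa [support_C_mul hc], hra, hs, (elim_C_mul c p r.poly a).symm⟩

theorem SafeReduces.C_mul {B : Set (LabeledPoly n K)} {s : Sig n} {p q : MvPolynomial (Fin n) K}
    (h : SafeReduces mo B s p q) {c : K} (hc : c ≠ 0) :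
    SafeReduces mo B s (C c * p) (C c * q) :=
  Relation.ReflTransGen.lift (C c * ·) (fun _ _ h => SafeRedStep.C_mul h hc) _ _ h

theorem SafeReduces.mono {B B' : Set (LabeledPoly n K)} {s : Sig n}
    {p q : MvPolynomial (Fin n) K} (h : SafeReduces mo B s p q) (hB : B ⊆ B') :
    SafeReduces mo B' s p q :=
  Relation.ReflTransGen.mono (fun _ _ ⟨r, hr, h⟩ => ⟨r, hB hr, h⟩) _ _ h

theorem SafeReduces.homogeneous {B : Set (LabeledPoly n K)} {s : Sig n}
    {p q : MvPolynomial (Fin n) K} (h : SafeReduces mo B s p q)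
    (hB : ∀ r ∈ B, r.poly ≠ 0 ∧ ∃ e, r.poly.IsHomogeneous e) {d : ℕ} (hp : p.IsHomogeneous d) :
    q.IsHomogeneous d := by
  induction h with
  | refl => exact hp
  | tail _ h ih =>
    obtain ⟨r, hr, a, ha, hra, -, rfl⟩ := h
    obtain ⟨h0, e, he⟩ := hB r hr
    exact elim_homogeneous ih he h0 ha hra

theorem SafeReduces.degree_le {B : Set (LabeledPoly n K)} {s : Sig n}
    {p q : MvPolynomial (Fin n) K} (h : SafeReduces mo B s p q) :
    mo.toSyn (mo.degree q) ≤ mo.toSyn (mo.degree p) := by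
  induction h with
  | refl => exact le_rfl
  | tail _ h ih =>
    obtain ⟨r, hr, a, ha, hra, -, rfl⟩ := h
    exact (degree_elim_le ha hra).trans ih

end Reduction

end F5

/-! ### Invariants of the memory and of the log, and their behaviour under changes of the memory -/

namespace F5

open MvPolynomial

variable {n m : ℕ} {K : Type*} [Field K] {mo : MonomialOrder (Fin n)}
  {f : Fin m → MvPolynomial (Fin n) K} {δ : ℕ → ℕ} {D : Mem n K}

/-! ### Invariants of the memory -/

/-- The invariants of the array `R` and of the rules. -/
structure MemOK (mo : MonomialOrder (Fin n)) (f : Fin m → MvPolynomial (Fin n) K) (δ : ℕ → ℕ)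
    (D : Mem n K) : Prop where
  le_N : m ≤ D.N
  input : ∀ k ≤ m, D.R k = (initMem mo f).R k
  hom : ∀ k ≤ D.N, (D.R k).poly.IsHomogeneous ((D.R k).sig.weight δ)
  sorted : ∀ i, (D.Rule i).Pairwise fun e e' => e'.2 < e.2
  sound : ∀ i, ∀ e ∈ D.Rule i, m < e.2 ∧ e.2 ≤ D.N ∧ (D.R e.2).sig = ⟨e.1, i⟩
  complete : ∀ k, m < k → k ≤ D.N → ((D.R k).sig.mono, k) ∈ D.Rule (D.R k).sig.index

/-- The rules are listed with decreasing positions, so the first match is the latest one, and it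
differs from the rule of the part exactly when it is later. The bound `m < j` appears because input
polynomials have no rules. -/
theorem MemOK.rewritten_iff (h : MemOK mo f δ D) {p : Part n} (hp : p.pos ≤ D.N) :
    D.Rewritten p ↔
      ∃ j, m < j ∧ p.pos < j ∧ j ≤ D.N ∧ Sig.Divides (D.R j).sig (D.partSig p) := by
  have key : ∀ e, (D.Rule (D.R p.pos).sig.index).find?
      (fun e => decide (e.1 ≤ (D.partSig p).mono)) = some e →
      ∀ j, m < j → j ≤ D.N → Sig.Divides (D.R j).sig (D.partSig p) → j ≤ e.2 := by
    intro e he j hmj hjN hdiv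
    obtain ⟨-, as, bs, heq, has⟩ := List.find?_eq_some_iff_append.mp he
    have hj := h.complete j hmj hjN
    have hidx : (D.R j).sig.index = (D.R p.pos).sig.index := hdiv.1
    rw [hidx, heq] at hj
    have hs := h.sorted (D.R p.pos).sig.index
    rw [heq, List.pairwise_append] at hs
    rcases List.mem_append.mp hj with hj | hj
    · have := has _ hj
      simp [hdiv.2] at this
    · rcases List.mem_cons.mp hj with hj | hj
      · rw [← hj]
      · exact (List.rel_of_pairwise_cons hs.2.1 hj).le
  constructor
  · rintro ⟨e, he, hne⟩
    obtain ⟨h1, h2, h3⟩ := h.sound _ e (List.mem_of_find?_eq_some he)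
    have h4 := List.find?_some he
    refine ⟨e.2, h1, ?_, h2, by rw [h3]; rfl, by rw [h3]; simpa using h4⟩
    -- An input position lies below every rule. Any other position has a rule of its own, which
    -- matches, so the rule found is at least as new.
    by_cases hpm : p.pos ≤ m
    · omega
    · refine lt_of_le_of_ne (key e he p.pos (by omega) hp ⟨rfl, ?_⟩) (Ne.symm hne)
      exact le_add_self
  · rintro ⟨j, hmj, hpj, hjN, hdiv⟩
    have hj := h.complete j hmj hjN
    have hidx : (D.R j).sig.index = (D.R p.pos).sig.index := hdiv.1
    rw [hidx] at hj
    have hsome : ((D.Rule (D.R p.pos).sig.index).find?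
        (fun e => decide (e.1 ≤ (D.partSig p).mono))).isSome := by
      rw [List.find?_isSome]
      exact ⟨_, hj, by simpa using hdiv.2⟩
    obtain ⟨e, he⟩ := Option.isSome_iff_exists.mp hsome
    have := key e he j hmj hjN hdiv
    exact ⟨e, he, by omega⟩

theorem MemOK.satisfiesRewritten (h : MemOK mo f δ D) {p : Part n} (hp : p.pos ≤ D.N)
    (hr : D.Rewritten p) : SatisfiesRewritten D p := by
  obtain ⟨j, -, h1, h2, h3⟩ := (h.rewritten_iff hp).mp hr
  exact ⟨j, h1, h2, h3⟩

/-- A monomial has a single term, so it is its own normal form exactly when no head monomial divides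
it; the choice of normal forms plays no role. -/
theorem nfCheckFails_iff (D : Mem n K) (L : List ℕ) (p : Part n) :
    D.NFCheckFails mo L p ↔ ∃ k ∈ L, D.hm mo k ≤ (D.partSig p).mono := by
  classical
  unfold Mem.NFCheckFails IsNormalForm
  constructor
  · intro h
    by_contra! hcon
    refine h ⟨.refl, ?_⟩
    rintro b ⟨k, hk, rfl⟩ a ha hba
    rw [support_monomial, if_neg one_ne_zero, Finset.mem_singleton] at ha
    exact hcon k hk (ha ▸ hba)
  · rintro ⟨k, hk, hle⟩ ⟨-, h⟩
    refine h _ ⟨k, hk, rfl⟩ (D.partSig p).mono ?_ hle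
    rw [support_monomial, if_neg one_ne_zero, Finset.mem_singleton]

/-! ### Invariants of the record of processing attempts -/

/-- The S-polynomial of two parts, multiplied by the product of the head coefficients. -/
noncomputable def spoly (mo : MonomialOrder (Fin n)) (D : Mem n K) (P Q : Part n) :
    MvPolynomial (Fin n) K :=
  C (mo.leadingCoeff (D.R Q.pos).poly) * D.partPoly P -
    C (mo.leadingCoeff (D.R P.pos).poly) * D.partPoly Q

/-- The polynomial at position `l` is, up to a constant, the result of a signature-safe reduction
of the S-polynomial of `P` and `Q` by the elements of `S`. -/
def ReducedFrom (mo : MonomialOrder (Fin n)) (D : Mem n K) (S : Set ℕ) (P Q : Part n) (l : ℕ) :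
    Prop :=
  ∃ c : K, c ≠ 0 ∧ ∃ q, SafeReduces mo (D.R '' S) (D.R l).sig (spoly mo D P Q) q ∧
    (D.R l).poly = C c * q

/-- The invariant of the record that the S-polynomial of `P` and `Q` was computed as `r_l`; the
polynomial of `Q` may have been reduced since then. -/
structure ComputedOK (mo : MonomialOrder (Fin n)) (m : ℕ) (D : Mem n K) (Gprev : List ℕ)
    (S T : Set ℕ) (P Q : Part n) (l : ℕ) : Prop where
  memP : P.pos ∈ S
  ltP : P.pos < l
  ltQ : Q.pos < l
  lt_l : m < l
  le_N : l ≤ D.N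
  sig_eq : (D.R l).sig = D.partSig P
  sig_le : Sig.Le mo (D.partSig Q) (D.partSig P)
  -- The first two alternatives are those in which the record has become irrelevant: `Q` has
  -- vanished, or its head has dropped. In the third, irreducibility of `Q` modulo `Gprev` is what
  -- protects the record from later normal forms.
  poly : (D.R Q.pos).poly = 0 ∨
    mo.toSyn (Q.mult + D.hm mo Q.pos) < mo.toSyn (P.mult + D.hm mo P.pos) ∨
    (Q.mult + D.hm mo Q.pos = P.mult + D.hm mo P.pos ∧ ReducedFrom mo D S P Q l ∧
      (Q.pos ∈ T → TermsIrreducible mo (D.polys Gprev) (D.R Q.pos).poly))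

/-- The invariant of a record of a processing attempt; `S` is the set of the positions which are
stored in `G` or `Done`, and `T` is the set of the positions still to be reduced. -/
def EntryOK (mo : MonomialOrder (Fin n)) (m : ℕ) (D : Mem n K) (Gprev : List ℕ) (S T : Set ℕ)
    (e : LogEntry n) : Prop :=
  match e.2 with
  | .rejectedNF p => p ∈ e.1 ∧ p.pos ≤ D.N ∧
      ∃ k ∈ S, (D.R p.pos).sig.index < (D.R k).sig.index ∧ D.hm mo k ≤ (D.partSig p).mono
  | .rejectedRW p => p ∈ e.1 ∧ p.pos ≤ D.N ∧ SatisfiesRewritten D p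
  | .computed l => ∃ P Q, e.1 = s(P, Q) ∧ ComputedOK mo m D Gprev S T P Q l

theorem partSig_congr {D' : Mem n K} {p : Part n} (h : (D'.R p.pos).sig = (D.R p.pos).sig) :
    D'.partSig p = D.partSig p := by
  rw [Mem.partSig, Mem.partSig, h]

/-- Rejections mention only signatures and stored polynomials, which are never altered; only records
of computed S-polynomials need an argument for each change. -/
theorem EntryOK.imp {D' : Mem n K} {Gprev Gprev' : List ℕ} {S S' T T' : Set ℕ} {e : LogEntry n}
    (h : EntryOK mo m D Gprev S T e) (hS : S ⊆ S') (hN : D.N ≤ D'.N)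
    (hle : ∀ x ∈ S, x ≤ D.N)
    (hsig : ∀ x ≤ D.N, (D'.R x).sig = (D.R x).sig) (hR : ∀ x ∈ S, D'.R x = D.R x)
    (hcomp : ∀ P Q l, ComputedOK mo m D Gprev S T P Q l → ComputedOK mo m D' Gprev' S' T' P Q l) :
    EntryOK mo m D' Gprev' S' T' e := by
  obtain ⟨pr, o⟩ := e
  cases o with
  | rejectedNF p =>
    obtain ⟨h1, h2, k, hk, h3, h4⟩ := h
    refine ⟨h1, h2.trans hN, k, hS hk, ?_, ?_⟩
    · rwa [hsig _ h2, hsig _ (hle _ hk)]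
    · rwa [partSig_congr (hsig _ h2), Mem.hm, hR _ hk]
  | rejectedRW p =>
    obtain ⟨h1, h2, j, h3, h4, h5⟩ := h
    refine ⟨h1, h2.trans hN, j, h3, h4.trans hN, ?_⟩
    rwa [partSig_congr (hsig _ h2), hsig _ h4]
  | computed l =>
    obtain ⟨P, Q, h1, h2⟩ := h
    exact ⟨P, Q, h1, hcomp P Q l h2⟩

theorem EntryOK.record {Gprev : List ℕ} {S T : Set ℕ} {e : LogEntry n}
    (h : EntryOK mo m D Gprev S T e) (hle : ∀ x ∈ S, x ≤ D.N) (es : List (LogEntry n)) :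
    EntryOK mo m (D.record es) Gprev S T e :=
  h.imp subset_rfl le_rfl hle (fun _ _ => rfl) (fun _ _ => rfl) fun _ _ _ hc =>
    ⟨hc.memP, hc.ltP, hc.ltQ, hc.lt_l, hc.le_N, hc.sig_eq, hc.sig_le, hc.poly⟩

/-- The S-pair of `r_a` and `r_b` has been processed. -/
def Logged (mo : MonomialOrder (Fin n)) (D : Mem n K) (a b : ℕ) : Prop :=
  ∃ o, (s(D.spairPart mo a b, D.spairPart mo b a), o) ∈ D.log

theorem Logged.symm {a b : ℕ} (h : Logged mo D a b) : Logged mo D b a := by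
  obtain ⟨o, h⟩ := h
  exact ⟨o, by rwa [Sym2.eq_swap]⟩

theorem spairPart_congr {D' : Mem n K} {a b : ℕ} (ha : D'.R a = D.R a) (hb : D'.R b = D.R b) :
    D'.spairPart mo a b = D.spairPart mo a b := by
  rw [Mem.spairPart, Mem.spairPart, Mem.hm, Mem.hm, ha, hb, Mem.hm, Mem.hm]

theorem Logged.mono {D' : Mem n K} {a b : ℕ} (h : Logged mo D a b) (ha : D'.R a = D.R a)
    (hb : D'.R b = D.R b) (hlog : D.log ⊆ D'.log) : Logged mo D' a b := by
  obtain ⟨o, h⟩ := h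
  exact ⟨o, by rw [spairPart_congr ha hb, spairPart_congr hb ha]; exact hlog h⟩

/-- The invariant of the memory relative to the call with index `i`, the previous result `Gprev`,
the set `S` of the positions stored in `G` or `Done`, and the set `T` of those to be reduced. -/
structure Config (mo : MonomialOrder (Fin n)) (f : Fin m → MvPolynomial (Fin n) K) (δ : ℕ → ℕ)
    (D : Mem n K) (i : ℕ) (Gprev : List ℕ) (S T : Set ℕ) : Prop where
  mem : MemOK mo f δ D
  le_m : i ≤ m
  stored_le : ∀ x ∈ S, x ≤ D.N
  todo : ∀ x ∈ T, m < x ∧ x ≤ D.N ∧ (D.R x).sig.index = i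
  disj : ∀ x ∈ S, x ∉ T
  lc : ∀ x ∈ S, mo.leadingCoeff (D.R x).poly = 1
  index : ∀ x ∈ S, x ∈ Gprev ∨ (D.R x).sig.index = i
  prev : ∀ x ∈ Gprev, x ∈ S ∧ i < (D.R x).sig.index
  alive : ∀ l, m < l → l ≤ D.N → l ∈ S ∨ l ∈ T ∨ (D.R l).poly = 0
  entries : ∀ e ∈ D.log, EntryOK mo m D Gprev S T e
  logged : ∀ a ∈ Gprev, ∀ b ∈ Gprev, a ≠ b → Logged mo D a b

namespace Config

variable {i : ℕ} {Gprev : List ℕ} {S T : Set ℕ}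

theorem ne_zero (h : Config mo f δ D i Gprev S T) {x : ℕ} (hx : x ∈ S) : (D.R x).poly ≠ 0 := by
  intro h0
  have := h.lc x hx
  simp [h0] at this

theorem hom_stored (h : Config mo f δ D i Gprev S T) :
    ∀ r ∈ D.R '' S, r.poly ≠ 0 ∧ ∃ e, r.poly.IsHomogeneous e := by
  rintro _ ⟨x, hx, rfl⟩
  exact ⟨h.ne_zero hx, _, h.mem.hom x (h.stored_le x hx)⟩

theorem index_ge (h : Config mo f δ D i Gprev S T) {x : ℕ} (hx : x ∈ S) :
    i ≤ (D.R x).sig.index := by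
  rcases h.index x hx with h' | h'
  · exact (h.prev x h').2.le
  · exact h'.ge

/-- The normal form with respect to `Gprev` is computed by signature-safe reductions. -/
theorem safeReduces (h : Config mo f δ D i Gprev S T) {s : Sig n} (hs : s.index = i)
    {p q : MvPolynomial (Fin n) K}
    (hr : Relation.ReflTransGen (RedStep mo (D.polys Gprev)) p q) :
    SafeReduces mo (D.R '' S) s p q := by
  refine Relation.ReflTransGen.mono ?_ _ _ hr
  rintro p q ⟨_, ⟨x, hx, rfl⟩, a, ha, hba, rfl⟩
  -- Elements of `Gprev` have index greater than `i`, so all their multiples have a signature below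
  -- `s`, whatever the monomial.
  refine ⟨D.R x, ⟨x, (h.prev x hx).1, rfl⟩, a, ha, hba, .inl ?_, rfl⟩
  rw [hs]
  exact (h.prev x hx).2

end Config

/-! ### Changing the memory -/

theorem setPoly_sig (D : Mem n K) (k x : ℕ) (p : MvPolynomial (Fin n) K) :
    ((D.setPoly k p).R x).sig = (D.R x).sig := by
  rcases eq_or_ne x k with rfl | hx
  · simp [Mem.setPoly]
  · simp [Mem.setPoly, hx]

theorem setPoly_self (D : Mem n K) (k : ℕ) (p : MvPolynomial (Fin n) K) :
    ((D.setPoly k p).R k).poly = p := by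
  simp [Mem.setPoly]

theorem setPoly_of_ne (D : Mem n K) {k x : ℕ} (p : MvPolynomial (Fin n) K) (hx : x ≠ k) :
    (D.setPoly k p).R x = D.R x := by
  simp [Mem.setPoly, hx]

theorem setPoly_eq_self (D : Mem n K) (k : ℕ) : D.setPoly k (D.R k).poly = D := by
  simp [Mem.setPoly]

theorem setPoly_setPoly (D : Mem n K) (k : ℕ) (p q : MvPolynomial (Fin n) K) :
    (D.setPoly k p).setPoly k q = D.setPoly k q := by
  simp [Mem.setPoly]

theorem setPoly_record (D : Mem n K) (k : ℕ) (p : MvPolynomial (Fin n) K)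
    (es : List (LogEntry n)) : (D.record es).setPoly k p = (D.setPoly k p).record es := rfl

theorem append_of_le (D : Mem n K) {x : ℕ} (s : Sig n) (p : MvPolynomial (Fin n) K)
    (hx : x ≤ D.N) : (D.append s p).R x = D.R x := by
  simp [Mem.append, show x ≠ D.N + 1 by omega]

theorem append_new (D : Mem n K) (s : Sig n) (p : MvPolynomial (Fin n) K) :
    (D.append s p).R (D.N + 1) = ⟨s, p⟩ := by
  simp [Mem.append]

theorem MemOK.setPoly (h : MemOK mo f δ D) {k : ℕ} (hk : m < k) {p : MvPolynomial (Fin n) K}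
    (hp : p.IsHomogeneous ((D.R k).sig.weight δ)) : MemOK mo f δ (D.setPoly k p) where
  le_N := h.le_N
  input x hx := by rw [setPoly_of_ne _ _ (by omega), h.input x hx]
  hom x hx := by
    rw [setPoly_sig]
    rcases eq_or_ne x k with rfl | hxk
    · rwa [setPoly_self]
    · rw [setPoly_of_ne _ _ hxk]
      exact h.hom x hx
  sorted := h.sorted
  sound j e he := by
    rw [setPoly_sig]
    exact h.sound j e he
  complete x h1 h2 := by
    rw [setPoly_sig]
    exact h.complete x h1 h2

theorem MemOK.append (h : MemOK mo f δ D) {s : Sig n} {p : MvPolynomial (Fin n) K}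
    (hp : p.IsHomogeneous (s.weight δ)) : MemOK mo f δ (D.append s p) where
  le_N := h.le_N.trans (Nat.le_succ _)
  input x hx := by rw [append_of_le _ _ _ (hx.trans h.le_N), h.input x hx]
  hom x hx := by
    rcases Nat.le_succ_iff.mp (show x ≤ D.N + 1 from hx) with hx | rfl
    · rw [append_of_le _ _ _ hx]
      exact h.hom x hx
    · rwa [append_new]
  sorted j := by
    rcases eq_or_ne j s.index with rfl | hj
    · simp only [Mem.append, Function.update_self, List.pairwise_cons]
      refine ⟨fun e he => ?_, h.sorted _⟩
      have := (h.sound _ e he).2.1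
      omega
    · simp only [Mem.append, Function.update_of_ne hj]
      exact h.sorted j
  sound j e he := by
    have hold : e ∈ D.Rule j → m < e.2 ∧ e.2 ≤ D.N + 1 ∧ ((D.append s p).R e.2).sig = ⟨e.1, j⟩ := by
      intro he
      obtain ⟨h1, h2, h3⟩ := h.sound j e he
      exact ⟨h1, by omega, by rwa [append_of_le _ _ _ h2]⟩
    rcases eq_or_ne j s.index with rfl | hj
    · simp only [Mem.append, Function.update_self, List.mem_cons] at he
      rcases he with rfl | he
      · exact ⟨Nat.lt_succ_of_le h.le_N, le_rfl, by rw [append_new]⟩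
      · exact hold he
    · simp only [Mem.append, Function.update_of_ne hj] at he
      exact hold he
  complete x h1 h2 := by
    rcases Nat.le_succ_iff.mp (show x ≤ D.N + 1 from h2) with hx | rfl
    · rw [append_of_le _ _ _ hx]
      have := h.complete x h1 hx
      rcases eq_or_ne (D.R x).sig.index s.index with hj | hj
      · simp only [Mem.append, hj, Function.update_self]
        exact List.mem_cons_of_mem _ (hj ▸ this)
      · simpa only [Mem.append, Function.update_of_ne hj] using this
    · rw [append_new]
      simp [Mem.append]

namespace Config

variable {i : ℕ} {Gprev : List ℕ} {S T : Set ℕ}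

theorem record (h : Config mo f δ D i Gprev S T) {es : List (LogEntry n)}
    (hes : ∀ e ∈ es, EntryOK mo m D Gprev S T e) : Config mo f δ (D.record es) i Gprev S T where
  mem := ⟨h.mem.le_N, h.mem.input, h.mem.hom, h.mem.sorted, h.mem.sound, h.mem.complete⟩
  le_m := h.le_m
  stored_le := h.stored_le
  todo := h.todo
  disj := h.disj
  lc := h.lc
  index := h.index
  prev := h.prev
  alive := h.alive
  entries e he := by
    rcases List.mem_append.mp he with he | he
    · exact (h.entries e he).record h.stored_le es
    · exact (hes e he).record h.stored_le es
  logged a ha b hb hab := (h.logged a ha b hb hab).mono rfl rfl (List.subset_append_left _ _)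

/-- Changing the polynomial at a position that is still to be reduced. -/
theorem setPoly_of_computed (h : Config mo f δ D i Gprev S T) {k : ℕ} (hk : k ∈ T)
    {p : MvPolynomial (Fin n) K} (hp : p.IsHomogeneous ((D.R k).sig.weight δ))
    (h0 : (D.R k).poly = 0 → p = 0)
    (hcomp : ∀ P Q l, ComputedOK mo m D Gprev S T P Q l →
      ComputedOK mo m (D.setPoly k p) Gprev S T P Q l) :
    Config mo f δ (D.setPoly k p) i Gprev S T := by
  have hR : ∀ x ∈ S, (D.setPoly k p).R x = D.R x := fun x hx =>
    setPoly_of_ne _ _ fun hxk => h.disj x hx (hxk ▸ hk)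
  refine ⟨h.mem.setPoly (h.todo k hk).1 hp, h.le_m, h.stored_le, ?_, h.disj, ?_, ?_, ?_, ?_, ?_, ?_⟩
  · intro x hx
    rw [setPoly_sig]
    exact h.todo x hx
  · intro x hx
    rw [hR x hx, h.lc x hx]
  · intro x hx
    rw [setPoly_sig]
    exact h.index x hx
  · intro x hx
    rw [setPoly_sig]
    exact h.prev x hx
  · intro l h1 h2
    rcases h.alive l h1 h2 with h' | h' | h'
    · exact .inl h'
    · exact .inr (.inl h')
    · right; right
      rcases eq_or_ne l k with rfl | hlk
      · rw [setPoly_self, h0 h']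
      · rwa [setPoly_of_ne _ _ hlk]
  · intro e he
    exact (h.entries e he).imp subset_rfl le_rfl h.stored_le (fun x _ => setPoly_sig _ _ _ _) hR hcomp
  · intro a ha b hb hab
    exact (h.logged a ha b hb hab).mono (hR a (h.prev a ha).1) (hR b (h.prev b hb).1)
      (List.Subset.refl _)

theorem image_setPoly (h : Config mo f δ D i Gprev S T) {k : ℕ} (hk : k ∈ T)
    (p : MvPolynomial (Fin n) K) : (D.setPoly k p).R '' S = D.R '' S :=
  Set.image_congr fun x hx => setPoly_of_ne _ _ fun hxk => h.disj x hx (hxk ▸ hk)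

theorem polys_setPoly (h : Config mo f δ D i Gprev S T) {k : ℕ} (hk : k ∈ T)
    (p : MvPolynomial (Fin n) K) : (D.setPoly k p).polys Gprev = D.polys Gprev := by
  ext q
  refine exists_congr fun x => and_congr_right fun hx => ?_
  have hxk : x ≠ k := fun hxk => h.disj x (h.prev x hx).1 (hxk ▸ hk)
  rw [setPoly_of_ne _ _ hxk]

theorem spoly_setPoly {k : ℕ} (p : MvPolynomial (Fin n) K) {P Q : Part n} (hP : P.pos ≠ k)
    (hQ : Q.pos ≠ k) : spoly mo (D.setPoly k p) P Q = spoly mo D P Q := by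
  simp only [spoly, Mem.partPoly, setPoly_of_ne _ _ hP, setPoly_of_ne _ _ hQ]

/-- A signature-safe reduction of a polynomial which either is a reduction of its head term, or
leaves the polynomials that are irreducible with respect to `Gprev` unchanged. -/
theorem setPoly_reduces (h : Config mo f δ D i Gprev S T) {k : ℕ} (hk : k ∈ T)
    {p : MvPolynomial (Fin n) K} (hred : SafeReduces mo (D.R '' S) (D.R k).sig (D.R k).poly p)
    (hp : (p = 0 ∨ mo.toSyn (mo.degree p) < mo.toSyn (mo.degree (D.R k).poly)) ∨
      (TermsIrreducible mo (D.polys Gprev) (D.R k).poly → p = (D.R k).poly)) :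
    Config mo f δ (D.setPoly k p) i Gprev S T := by
  rcases eq_or_ne p (D.R k).poly with rfl | hne
  · rwa [setPoly_eq_self]
  have h0 : (D.R k).poly = 0 → p = 0 := by
    intro h0
    rcases Relation.ReflTransGen.cases_head hred with h' | ⟨r, ⟨b, -, a, ha, -⟩, -⟩
    · rw [← h', h0]
    · simp [h0] at ha
  refine h.setPoly_of_computed hk (hred.homogeneous h.hom_stored (h.mem.hom k (h.todo k hk).2.1))
    h0 ?_
  intro P Q l hc
  have hPk : P.pos ≠ k := fun hPk => h.disj _ hc.memP (hPk ▸ hk)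
  refine ⟨hc.memP, hc.ltP, hc.ltQ, hc.lt_l, hc.le_N, ?_, ?_, ?_⟩
  · rw [setPoly_sig, hc.sig_eq, partSig_congr (setPoly_sig _ _ _ _)]
  · rw [partSig_congr (setPoly_sig _ _ _ _), partSig_congr (setPoly_sig _ _ _ _)]
    exact hc.sig_le
  simp only [Mem.hm, setPoly_of_ne _ _ hPk, h.polys_setPoly hk]
  rcases eq_or_ne Q.pos k with hQk | hQk
  · rw [hQk, setPoly_self]
    rcases hc.poly with h' | h' | ⟨h1, h2, h3⟩
    · exact .inl (h0 (hQk ▸ h'))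
    · right; left
      refine lt_of_le_of_lt ?_ h'
      rw [map_add, map_add, Mem.hm, hQk]
      exact add_le_add_right hred.degree_le _
    -- A head reduction moves the record to one of the irrelevant alternatives; a normal form would
    -- fix the irreducible polynomial of `Q`, contrary to `hne`.
    · rcases hp with (hp | hp) | hp
      · exact .inl hp
      · right; left
        change _ < mo.toSyn (P.mult + D.hm mo P.pos)
        rw [← h1, map_add, map_add, Mem.hm, hQk]
        exact add_lt_add_right hp _
      · exact absurd (hp (hQk ▸ h3 (hQk ▸ hk))) hne
  · rw [setPoly_of_ne _ _ hQk]
    refine hc.poly.imp_right (Or.imp_right fun ⟨h1, h2, h3⟩ => ⟨h1, ?_, h3⟩)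
    obtain ⟨c, hc0, q, hq, hlq⟩ := h2
    rw [ReducedFrom, h.image_setPoly hk, spoly_setPoly _ hPk hQk, setPoly_sig]
    rcases eq_or_ne l k with rfl | hlk
    -- Here the changed polynomial is the S-polynomial itself: the new reduction, scaled by `c⁻¹`,
    -- prolongs the recorded one.
    · refine ⟨c, hc0, C c⁻¹ * p, hq.trans ?_, ?_⟩
      · have := SafeReduces.C_mul hred (inv_ne_zero hc0)
        rwa [hlq, ← mul_assoc, ← C_mul, inv_mul_cancel₀ hc0, C_1, one_mul] at this
      · rw [setPoly_self, ← mul_assoc, ← C_mul, mul_inv_cancel₀ hc0, C_1, one_mul]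
    · exact ⟨c, hc0, q, hq, by rw [setPoly_of_ne _ _ hlk, hlq]⟩

/-- Multiplying a polynomial by a nonzero constant. -/
theorem scale (h : Config mo f δ D i Gprev S T) {k : ℕ} (hk : k ∈ T) {u : K} (hu : u ≠ 0) :
    Config mo f δ (D.setPoly k (C u * (D.R k).poly)) i Gprev S T := by
  refine h.setPoly_of_computed hk ((h.mem.hom k (h.todo k hk).2.1).C_mul u)
    (fun h0 => by rw [h0, mul_zero]) ?_
  intro P Q l hc
  have hPk : P.pos ≠ k := fun hPk => h.disj _ hc.memP (hPk ▸ hk)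
  have hhm : ∀ x, mo.degree ((D.setPoly k (C u * (D.R k).poly)).R x).poly = mo.degree (D.R x).poly := by
    intro x
    rcases eq_or_ne x k with rfl | hx
    · rw [setPoly_self, degree_C_mul hu]
    · rw [setPoly_of_ne _ _ hx]
  refine ⟨hc.memP, hc.ltP, hc.ltQ, hc.lt_l, hc.le_N, ?_, ?_, ?_⟩
  · rw [setPoly_sig, hc.sig_eq, partSig_congr (setPoly_sig _ _ _ _)]
  · rw [partSig_congr (setPoly_sig _ _ _ _), partSig_congr (setPoly_sig _ _ _ _)]
    exact hc.sig_le
  simp only [Mem.hm, hhm, h.polys_setPoly hk]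
  refine hc.poly.imp (fun h0 => ?_) (Or.imp_right fun ⟨h1, h2, h3⟩ => ⟨h1, ?_, fun hQT => ?_⟩)
  · rcases eq_or_ne Q.pos k with hQk | hQk
    · rw [hQk, setPoly_self, ← hQk, h0, mul_zero]
    · rwa [setPoly_of_ne _ _ hQk]
  · obtain ⟨c, hc0, q, hq, hlq⟩ := h2
    rw [ReducedFrom, h.image_setPoly hk, setPoly_sig]
    rcases eq_or_ne l k with rfl | hlk
    · rw [spoly_setPoly _ hPk hc.ltQ.ne, setPoly_self]
      exact ⟨u * c, mul_ne_zero hu hc0, q, hq, by rw [hlq, C_mul, mul_assoc]⟩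
    rw [setPoly_of_ne _ _ hlk]
    rcases eq_or_ne Q.pos k with hQk | hQk
    -- `spoly` contains `Q` once as a polynomial and once through its head coefficient in front of
    -- `P`, so scaling `Q` by `u` scales all of it by `u`.
    · refine ⟨c * u⁻¹, mul_ne_zero hc0 (inv_ne_zero hu), C u * q, ?_, ?_⟩
      · have := SafeReduces.C_mul hq hu
        convert this using 1
        simp only [spoly, Mem.partPoly, setPoly_of_ne _ _ hPk, hQk, setPoly_self,
          leadingCoeff_C_mul hu, C_mul]
        ring
      · rw [hlq, C_mul, mul_assoc, ← mul_assoc (C u⁻¹), ← C_mul, inv_mul_cancel₀ hu, C_1, one_mul]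
    · rw [spoly_setPoly _ hPk hQk]
      exact ⟨c, hc0, q, hq, hlq⟩
  · have := h3 hQT
    rcases eq_or_ne Q.pos k with hQk | hQk
    · rw [hQk, setPoly_self, TermsIrreducible, support_C_mul hu, ← hQk]
      exact this
    · rwa [setPoly_of_ne _ _ hQk]

/-- Appending a new labeled polynomial. -/
theorem append (h : Config mo f δ D i Gprev S T) {s : Sig n} (hs : s.index = i)
    {p : MvPolynomial (Fin n) K} (hp : p.IsHomogeneous (s.weight δ)) :
    Config mo f δ (D.append s p) i Gprev S (insert (D.N + 1) T) := by
  have hR : ∀ x ∈ S, (D.append s p).R x = D.R x := fun x hx =>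
    append_of_le _ _ _ (h.stored_le x hx)
  have hprev : ∀ x ∈ Gprev, (D.append s p).R x = D.R x := fun x hx => hR x (h.prev x hx).1
  have hpolys : (D.append s p).polys Gprev = D.polys Gprev := by
    ext q
    exact exists_congr fun x => and_congr_right fun hx => by rw [hprev x hx]
  refine ⟨h.mem.append hp, h.le_m, fun x hx => (h.stored_le x hx).trans (Nat.le_succ _), ?_, ?_, ?_,
    ?_, ?_, ?_, ?_, ?_⟩
  · rintro x (rfl | hx)
    · exact ⟨Nat.lt_succ_of_le h.mem.le_N, le_rfl, by rw [append_new, hs]⟩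
    · obtain ⟨h1, h2, h3⟩ := h.todo x hx
      exact ⟨h1, h2.trans (Nat.le_succ _), by rwa [append_of_le _ _ _ h2]⟩
  · rintro x hx (rfl | hx')
    · exact absurd (h.stored_le _ hx) (by omega)
    · exact h.disj x hx hx'
  · intro x hx
    rw [hR x hx, h.lc x hx]
  · intro x hx
    rw [hR x hx]
    exact h.index x hx
  · intro x hx
    rw [hprev x hx]
    exact h.prev x hx
  · intro l h1 h2
    rcases Nat.le_succ_iff.mp (show l ≤ D.N + 1 from h2) with hl | rfl
    · rw [append_of_le _ _ _ hl]
      exact (h.alive l h1 hl).imp_right (Or.imp_left (Set.mem_insert_of_mem _))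
    · exact .inr (.inl (Set.mem_insert _ _))
  · intro e he
    refine (h.entries e he).imp subset_rfl (Nat.le_succ _) h.stored_le
      (fun x hx => by rw [append_of_le _ _ _ hx]) hR ?_
    intro P Q l hc
    have hP : (D.append s p).R P.pos = D.R P.pos := hR _ hc.memP
    have hl : (D.append s p).R l = D.R l := append_of_le _ _ _ hc.le_N
    have hQ : (D.append s p).R Q.pos = D.R Q.pos := append_of_le _ _ _ (hc.ltQ.le.trans hc.le_N)
    refine ⟨hc.memP, hc.ltP, hc.ltQ, hc.lt_l, hc.le_N.trans (Nat.le_succ _), ?_, ?_, ?_⟩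
    · rw [hl, hc.sig_eq, Mem.partSig, Mem.partSig, hP]
    · rw [Mem.partSig, Mem.partSig, hP, hQ]
      exact hc.sig_le
    · simp only [Mem.hm, hP, hQ, ReducedFrom, hl, spoly, Mem.partPoly, Set.image_congr hR, hpolys]
      refine hc.poly.imp_right (Or.imp_right fun ⟨h1, h2, h3⟩ => ⟨h1, h2, fun hQT => ?_⟩)
      rcases hQT with hQT | hQT
      · exact absurd (hc.ltQ.trans_le hc.le_N) (by omega)
      · exact h3 hQT
  · intro a ha b hb hab
    exact (h.logged a ha b hb hab).mono (hprev a ha) (hprev b hb) (List.Subset.refl _)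

/-- `Gprev` matters only for positions still to be reduced. The form of `hT` therefore allows
`Gprev` to change when `T'` is empty, as at the start of a call. -/
theorem entries_mono (h : Config mo f δ D i Gprev S T) {Gprev' : List ℕ} {S' T' : Set ℕ}
    (hS : S ⊆ S') (hT : ∀ x ∈ T', x ∈ T ∧ Gprev = Gprev') :
    ∀ e ∈ D.log, EntryOK mo m D Gprev' S' T' e := by
  intro e he
  refine (h.entries e he).imp hS le_rfl h.stored_le (fun _ _ => rfl) (fun _ _ => rfl) ?_
  intro P Q l hc
  refine ⟨hS hc.memP, hc.ltP, hc.ltQ, hc.lt_l, hc.le_N, hc.sig_eq, hc.sig_le, ?_⟩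
  refine hc.poly.imp_right (Or.imp_right fun ⟨h1, h2, h3⟩ => ⟨h1, ?_, fun hQT => ?_⟩)
  · obtain ⟨c, hc0, q, hq, hlq⟩ := h2
    exact ⟨c, hc0, q, hq.mono (Set.image_mono hS), hlq⟩
  · obtain ⟨h4, rfl⟩ := hT _ hQT
    exact h3 h4

/-- A monic polynomial is moved to the stored ones. -/
theorem store (h : Config mo f δ D i Gprev S T) {k : ℕ} (hk : k ∈ T)
    (hlc : mo.leadingCoeff (D.R k).poly = 1) :
    Config mo f δ D i Gprev (insert k S) (T \ {k}) where
  mem := h.mem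
  le_m := h.le_m
  stored_le := by
    rintro x (rfl | hx)
    · exact (h.todo x hk).2.1
    · exact h.stored_le x hx
  todo x hx := h.todo x hx.1
  disj := by
    rintro x (rfl | hx) hx'
    · exact hx'.2 rfl
    · exact h.disj x hx hx'.1
  lc := by
    rintro x (rfl | hx)
    · exact hlc
    · exact h.lc x hx
  index := by
    rintro x (rfl | hx)
    · exact .inr (h.todo x hk).2.2
    · exact h.index x hx
  prev x hx := ⟨.inr (h.prev x hx).1, (h.prev x hx).2⟩
  alive l h1 h2 := by
    rcases eq_or_ne l k with rfl | hlk
    · exact .inl (.inl rfl)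
    · rcases h.alive l h1 h2 with h' | h' | h'
      · exact .inl (.inr h')
      · exact .inr (.inl ⟨h', hlk⟩)
      · exact .inr (.inr h')
  entries := h.entries_mono (Set.subset_insert _ _) fun _ hx => ⟨hx.1, rfl⟩
  logged := h.logged

/-- The zero polynomial is dropped. -/
theorem drop (h : Config mo f δ D i Gprev S T) {k : ℕ} (h0 : (D.R k).poly = 0) :
    Config mo f δ D i Gprev S (T \ {k}) where
  mem := h.mem
  le_m := h.le_m
  stored_le := h.stored_le
  todo x hx := h.todo x hx.1
  disj x hx hx' := h.disj x hx hx'.1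
  lc := h.lc
  index := h.index
  prev := h.prev
  alive l h1 h2 := by
    rcases eq_or_ne l k with rfl | hlk
    · exact .inr (.inr h0)
    · rcases h.alive l h1 h2 with h' | h' | h'
      · exact .inl h'
      · exact .inr (.inl ⟨h', hlk⟩)
      · exact .inr (.inr h')
  entries := h.entries_mono subset_rfl fun _ hx => ⟨hx.1, rfl⟩
  logged := h.logged

end Config

end F5

/-! ### What the creation of critical pairs and the search for a reductor leave behind -/

namespace F5

open MvPolynomial

variable {n m : ℕ} {K : Type*} [Field K] {mo : MonomialOrder (Fin n)}
  {f : Fin m → MvPolynomial (Fin n) K} {δ : ℕ → ℕ} {D : Mem n K}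
  {i : ℕ} {Gprev : List ℕ} {S T : Set ℕ}

/-! ### Critical pairs -/

/-- `cp` is a critical pair of two elements of `G`, of index `i`. -/
def PairOK (mo : MonomialOrder (Fin n)) (D : Mem n K) (i : ℕ) (G : List ℕ) (cp : CritPair n) :
    Prop :=
  ∃ x ∈ G, ∃ y ∈ G, cp = ⟨D.hm mo x ⊔ D.hm mo y, D.spairPart mo x y, D.spairPart mo y x⟩ ∧
    Sig.Le mo (D.partSig (D.spairPart mo y x)) (D.partSig (D.spairPart mo x y)) ∧
    (D.R x).sig.index = i

/-- The pairs in `P` are critical pairs of elements of `G`, and every S-pair of elements of `G`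
either has been processed or is in `P`. -/
def Pend (mo : MonomialOrder (Fin n)) (D : Mem n K) (i : ℕ) (G : List ℕ) (P : List (CritPair n)) :
    Prop :=
  (∀ cp ∈ P, PairOK mo D i G cp) ∧ ∀ a ∈ G, ∀ b ∈ G, a ≠ b → Logged mo D a b ∨
    ∃ cp ∈ P, s(cp.hi, cp.lo) = s(D.spairPart mo a b, D.spairPart mo b a)

theorem PairOK.congr {D' : Mem n K} {G G' : List ℕ} {cp : CritPair n} (h : PairOK mo D i G cp)
    (hR : ∀ x ∈ G, D'.R x = D.R x) (hG : G ⊆ G') : PairOK mo D' i G' cp := by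
  obtain ⟨x, hx, y, hy, h1, h2, h3⟩ := h
  refine ⟨x, hG hx, y, hG hy, ?_, ?_, ?_⟩
  · rw [h1, spairPart_congr (hR x hx) (hR y hy), spairPart_congr (hR y hy) (hR x hx), Mem.hm,
      Mem.hm, Mem.hm, Mem.hm, hR x hx, hR y hy]
  · rw [spairPart_congr (hR x hx) (hR y hy), spairPart_congr (hR y hy) (hR x hx), Mem.partSig,
      Mem.partSig]
    simp only [Mem.spairPart, hR x hx, hR y hy]
    exact h2
  · rw [hR x hx, h3]

theorem Pend.congr {D' : Mem n K} {G : List ℕ} {P : List (CritPair n)} (h : Pend mo D i G P)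
    (hR : ∀ x ∈ G, D'.R x = D.R x) (hlog : D.log ⊆ D'.log) : Pend mo D' i G P := by
  refine ⟨fun cp hcp => (h.1 cp hcp).congr hR (List.Subset.refl _), fun a ha b hb hab => ?_⟩
  rcases h.2 a ha b hb hab with h' | h'
  · exact .inl (h'.mono (hR a ha) (hR b hb) hlog)
  · rw [spairPart_congr (hR a ha) (hR b hb), spairPart_congr (hR b hb) (hR a ha)]
    exact .inr h'

theorem Pend.logged_of_nil {G : List ℕ} (h : Pend mo D i G []) :
    ∀ a ∈ G, ∀ b ∈ G, a ≠ b → Logged mo D a b := by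
  intro a ha b hb hab
  simpa using h.2 a ha b hb hab

theorem PairOK.lcm_eq {G : List ℕ} {cp : CritPair n} (h : PairOK mo D i G cp) {a b : ℕ}
    (hs : s(cp.hi, cp.lo) = s(D.spairPart mo a b, D.spairPart mo b a)) :
    cp.lcm = D.hm mo a ⊔ D.hm mo b := by
  obtain ⟨x, -, y, -, rfl, -, -⟩ := h
  rcases Sym2.eq_iff.mp hs with ⟨h1, h2⟩ | ⟨h1, h2⟩
  · obtain rfl : x = a := congrArg Part.pos h1
    obtain rfl : y = b := congrArg Part.pos h2
    rfl
  · obtain rfl : x = b := congrArg Part.pos h1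
    obtain rfl : y = a := congrArg Part.pos h2
    exact sup_comm _ _

theorem EntryOK.of_nfCheckFails (h : Config mo f δ D i Gprev S T) {p : Part n} {pr : Sym2 (Part n)}
    (hp : p ∈ pr) (hN : p.pos ≤ D.N) (hi : (D.R p.pos).sig.index = i)
    (hf : D.NFCheckFails mo Gprev p) : EntryOK mo m D Gprev S T (pr, .rejectedNF p) := by
  obtain ⟨k, hk, hle⟩ := (nfCheckFails_iff _ _ _).mp hf
  exact ⟨hp, hN, k, (h.prev k hk).1, hi ▸ (h.prev k hk).2, hle⟩

theorem EntryOK.of_rewritten (h : Config mo f δ D i Gprev S T) {p : Part n} {pr : Sym2 (Part n)}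
    (hp : p ∈ pr) (hN : p.pos ≤ D.N) (hr : D.Rewritten p) :
    EntryOK mo m D Gprev S T (pr, .rejectedRW p) :=
  ⟨hp, hN, h.mem.satisfiesRewritten hN hr⟩

-- Since `r_a` has the current index, so has the part of greater signature. The branch of `critPair`
-- that discards a pair without a record is thus never taken, and the pair is either logged or
-- pending.
open Classical in
theorem critPair_spec (h : Config mo f δ D i Gprev S T) {a b : ℕ} (ha : a ∈ S) (hb : b ∈ S)
    (hi : (D.R a).sig.index = i) :
    (∀ e ∈ (D.critPair mo Gprev i a b).1, EntryOK mo m D Gprev S T e) ∧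
    (∀ cp ∈ (D.critPair mo Gprev i a b).2, PairOK mo D i [a, b] cp) ∧
    ((∃ o, (s(D.spairPart mo a b, D.spairPart mo b a), o) ∈ (D.critPair mo Gprev i a b).1) ∨
      ∃ cp ∈ (D.critPair mo Gprev i a b).2,
        s(cp.hi, cp.lo) = s(D.spairPart mo a b, D.spairPart mo b a)) := by
  obtain ⟨x, y, hxy, hhi, hlo, hle⟩ : ∃ x y, (x = a ∧ y = b ∨ x = b ∧ y = a) ∧
      (if Sig.Lt mo (D.partSig (D.spairPart mo a b)) (D.partSig (D.spairPart mo b a))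
        then D.spairPart mo b a else D.spairPart mo a b) = D.spairPart mo x y ∧
      (if Sig.Lt mo (D.partSig (D.spairPart mo a b)) (D.partSig (D.spairPart mo b a))
        then D.spairPart mo a b else D.spairPart mo b a) = D.spairPart mo y x ∧
      Sig.Le mo (D.partSig (D.spairPart mo y x)) (D.partSig (D.spairPart mo x y)) := by
    by_cases hlt : Sig.Lt mo (D.partSig (D.spairPart mo a b)) (D.partSig (D.spairPart mo b a))
    · exact ⟨b, a, .inr ⟨rfl, rfl⟩, if_pos hlt, if_pos hlt, .inl hlt⟩
    · exact ⟨a, b, .inl ⟨rfl, rfl⟩, if_neg hlt, if_neg hlt, Sig.le_of_not_lt hlt⟩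
  have hx : x ∈ S ∧ x ∈ [a, b] := by rcases hxy with ⟨rfl, rfl⟩ | ⟨rfl, rfl⟩ <;> simp [ha, hb]
  have hy : y ∈ S ∧ y ∈ [a, b] := by rcases hxy with ⟨rfl, rfl⟩ | ⟨rfl, rfl⟩ <;> simp [ha, hb]
  have hlcm : D.hm mo a ⊔ D.hm mo b = D.hm mo x ⊔ D.hm mo y := by
    rcases hxy with ⟨rfl, rfl⟩ | ⟨rfl, rfl⟩
    · rfl
    · exact sup_comm _ _
  have hpr : s(D.spairPart mo a b, D.spairPart mo b a) =
      s(D.spairPart mo x y, D.spairPart mo y x) := by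
    rcases hxy with ⟨rfl, rfl⟩ | ⟨rfl, rfl⟩
    · rfl
    · exact Sym2.eq_swap
  -- The greater signature has the smaller index, no stored index is below `i`, and one of the two
  -- is `i`.
  have hix : (D.R x).sig.index = i := by
    have h1 : (D.R x).sig.index ≤ (D.R y).sig.index := hle.index_le
    have h2 := h.index_ge hx.1
    rcases hxy with ⟨rfl, rfl⟩ | ⟨rfl, rfl⟩ <;> omega
  have hnot : ¬ i < (D.partSig (D.spairPart mo x y)).index := by
    change ¬ i < (D.R x).sig.index
    omega
  simp only [Mem.critPair, hhi, hlo, hlcm, hpr, if_neg hnot]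
  split_ifs with h1 h2
  · refine ⟨fun e he => ?_, by simp, .inl ⟨_, List.mem_singleton.mpr rfl⟩⟩
    rw [List.mem_singleton.mp he]
    exact .of_nfCheckFails h (Sym2.mem_mk_left _ _) (h.stored_le x hx.1) hix h1
  · refine ⟨fun e he => ?_, by simp, .inl ⟨_, List.mem_singleton.mpr rfl⟩⟩
    rw [List.mem_singleton.mp he]
    exact .of_nfCheckFails h (Sym2.mem_mk_right _ _) (h.stored_le y hy.1) h2.1 h2.2
  · refine ⟨by simp, fun cp hcp => ?_, .inr ⟨_, List.mem_singleton.mpr rfl, rfl⟩⟩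
    exact ⟨x, hx.2, y, hy.2, List.mem_singleton.mp hcp, hle, hix⟩

/-- A stored position `k` is added to `G`, with its critical pairs. -/
theorem Config.addToG (h : Config mo f δ D i Gprev S T) {G : List ℕ} {P : List (CritPair n)}
    (hP : Pend mo D i G P) (hG : ∀ x ∈ G, x ∈ S) {k : ℕ} (hk : k ∈ S)
    (hi : (D.R k).sig.index = i) :
    Config mo f δ (D.record (D.critPairs mo Gprev i k G).1) i Gprev S T ∧
    Pend mo (D.record (D.critPairs mo Gprev i k G).1) i (G ++ [k])
      (P ++ (D.critPairs mo Gprev i k G).2) := by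
  constructor
  · refine h.record fun e he => ?_
    obtain ⟨b, hb, he⟩ := List.mem_flatMap.mp he
    exact (critPair_spec h hk (hG b hb) hi).1 e he
  set D' := D.record (D.critPairs mo Gprev i k G).1
  have hnew : ∀ b ∈ G, Logged mo D' k b ∨ ∃ cp ∈ P ++ (D.critPairs mo Gprev i k G).2,
      s(cp.hi, cp.lo) = s(D.spairPart mo k b, D.spairPart mo b k) := by
    intro b hb
    rcases (critPair_spec h hk (hG b hb) hi).2.2 with ⟨o, ho⟩ | ⟨cp, hcp, hs⟩
    · exact .inl ⟨o, List.mem_append_right _ (List.mem_flatMap.mpr ⟨b, hb, ho⟩)⟩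
    · exact .inr ⟨cp, List.mem_append_right _ (List.mem_flatMap.mpr ⟨b, hb, hcp⟩), hs⟩
  constructor
  · intro cp hcp
    rcases List.mem_append.mp hcp with hcp | hcp
    · exact (hP.1 cp hcp).congr (fun _ _ => rfl) (List.subset_append_left _ _)
    · obtain ⟨b, hb, hcp⟩ := List.mem_flatMap.mp hcp
      refine ((critPair_spec h hk (hG b hb) hi).2.1 cp hcp).congr (fun _ _ => rfl) ?_
      intro x hx
      simp only [List.mem_cons, List.not_mem_nil, or_false] at hx
      rcases hx with rfl | rfl <;> simp [hb]
  · intro a ha b hb hab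
    rw [List.mem_append, List.mem_singleton] at ha hb
    rcases ha with ha | rfl
    · rcases hb with hb | rfl
      · rcases hP.2 a ha b hb hab with h' | ⟨cp, hcp, hs⟩
        · exact .inl (h'.mono rfl rfl (List.subset_append_left _ _))
        · exact .inr ⟨cp, List.mem_append_left _ hcp, hs⟩
      · refine (hnew a ha).imp Logged.symm fun ⟨cp, hcp, hs⟩ => ⟨cp, hcp, ?_⟩
        rw [hs, Sym2.eq_swap]
        rfl
    · rcases hb with hb | rfl
      · exact hnew b hb
      · exact absurd rfl hab

/-! ### The search for a reductor -/

theorem isReducible_entries {k : ℕ} {L : List ℕ} {es : List (LogEntry n)} {o : Option ℕ}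
    (h : D.isReducible mo Gprev k L = (es, o)) {e : LogEntry n} (he : e ∈ es) :
    ∃ j ∈ L, D.hm mo j ≤ D.hm mo k ∧
      ((e = (s(⟨D.hm mo k - D.hm mo j, j⟩, ⟨0, k⟩), .rejectedNF ⟨D.hm mo k - D.hm mo j, j⟩) ∧
        D.NFCheckFails mo Gprev ⟨D.hm mo k - D.hm mo j, j⟩) ∨
      (e = (s(⟨D.hm mo k - D.hm mo j, j⟩, ⟨0, k⟩), .rejectedRW ⟨D.hm mo k - D.hm mo j, j⟩) ∧
        D.Rewritten ⟨D.hm mo k - D.hm mo j, j⟩)) := by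
  induction L generalizing es o with
  | nil =>
    rw [Mem.isReducible, Prod.mk.injEq] at h
    simp [← h.1] at he
  | cons j L ih =>
    have hmem : ∀ {e'}, e' ∈ L → e' ∈ j :: L := List.mem_cons_of_mem _
    rw [Mem.isReducible] at h
    split_ifs at h with h1 h2 h3 h4
    · rw [Prod.mk.injEq] at h
      rw [← h.1] at he
      rcases List.mem_cons.mp he with he | he
      · exact ⟨j, List.mem_cons_self, h1, .inl ⟨he, h2⟩⟩
      · obtain ⟨x, hx, h'⟩ := ih rfl he
        exact ⟨x, hmem hx, h'⟩
    · rw [Prod.mk.injEq] at h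
      rw [← h.1] at he
      rcases List.mem_cons.mp he with he | he
      · exact ⟨j, List.mem_cons_self, h1, .inr ⟨he, h3⟩⟩
      · obtain ⟨x, hx, h'⟩ := ih rfl he
        exact ⟨x, hmem hx, h'⟩
    · obtain ⟨x, hx, h'⟩ := ih h he
      exact ⟨x, hmem hx, h'⟩
    · rw [Prod.mk.injEq] at h
      simp [← h.1] at he
    · obtain ⟨x, hx, h'⟩ := ih h he
      exact ⟨x, hmem hx, h'⟩

/-- Only checks (a) and (d) pass over a candidate silently, and (a) is excluded by `hle`. As (c)
precedes (d), a candidate stopped by (d) is known not to be rewritten. -/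
theorem isReducible_none {k : ℕ} {L : List ℕ} {es : List (LogEntry n)}
    (h : D.isReducible mo Gprev k L = (es, none)) {j : ℕ} (hj : j ∈ L)
    (hle : D.hm mo j ≤ D.hm mo k) :
    (∃ o, (s(⟨D.hm mo k - D.hm mo j, j⟩, ⟨0, k⟩), o) ∈ es) ∨
      (¬ D.Rewritten ⟨D.hm mo k - D.hm mo j, j⟩ ∧
        D.partSig ⟨D.hm mo k - D.hm mo j, j⟩ = (D.R k).sig) := by
  induction L generalizing es with
  | nil => simp at hj
  | cons x L ih =>
    rw [Mem.isReducible] at h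
    split_ifs at h with h1 h2 h3 h4
    · rw [Prod.mk.injEq] at h
      rw [← h.1]
      rcases List.mem_cons.mp hj with rfl | hj
      · exact .inl ⟨_, List.mem_cons_self⟩
      · exact (ih (Prod.ext rfl h.2) hj).imp_left fun ⟨o, ho⟩ => ⟨o, List.mem_cons_of_mem _ ho⟩
    · rw [Prod.mk.injEq] at h
      rw [← h.1]
      rcases List.mem_cons.mp hj with rfl | hj
      · exact .inl ⟨_, List.mem_cons_self⟩
      · exact (ih (Prod.ext rfl h.2) hj).imp_left fun ⟨o, ho⟩ => ⟨o, List.mem_cons_of_mem _ ho⟩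
    · rcases List.mem_cons.mp hj with rfl | hj
      · exact .inr ⟨h3, h4⟩
      · exact ih h hj
    · simp at h
    · rcases List.mem_cons.mp hj with rfl | hj
      · exact absurd hle h1
      · exact ih h hj

theorem isReducible_some {k j : ℕ} {L : List ℕ} {es : List (LogEntry n)}
    (h : D.isReducible mo Gprev k L = (es, some j)) :
    j ∈ L ∧ D.hm mo j ≤ D.hm mo k ∧ ¬ D.Rewritten ⟨D.hm mo k - D.hm mo j, j⟩ ∧
      D.partSig ⟨D.hm mo k - D.hm mo j, j⟩ ≠ (D.R k).sig := by
  induction L generalizing es with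
  | nil => simp [Mem.isReducible] at h
  | cons x L ih =>
    rw [Mem.isReducible] at h
    split_ifs at h with h1 h2 h3 h4
    · rw [Prod.mk.injEq] at h
      exact (ih (Prod.ext rfl h.2)).imp_left (List.mem_cons_of_mem _)
    · rw [Prod.mk.injEq] at h
      exact (ih (Prod.ext rfl h.2)).imp_left (List.mem_cons_of_mem _)
    · exact (ih h).imp_left (List.mem_cons_of_mem _)
    · rw [Prod.mk.injEq, Option.some.injEq] at h
      obtain ⟨-, rfl⟩ := h
      exact ⟨List.mem_cons_self, h1, h3, h4⟩
    · exact (ih h).imp_left (List.mem_cons_of_mem _)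

/-- The rejections recorded in the search for a reductor of a polynomial which is irreducible with
respect to `Gprev`. -/
theorem Config.record_isReducible (h : Config mo f δ D i Gprev S T) {k : ℕ}
    (h0 : (D.R k).poly ≠ 0) (hirr : TermsIrreducible mo (D.polys Gprev) (D.R k).poly)
    {L : List ℕ} (hL : ∀ x ∈ L, x ∈ S) {es : List (LogEntry n)} {o : Option ℕ}
    (hes : D.isReducible mo Gprev k L = (es, o)) :
    Config mo f δ (D.record es) i Gprev S T := by
  refine h.record fun e he => ?_
  obtain ⟨j, hj, hle, ⟨rfl, hf⟩ | ⟨rfl, hr⟩⟩ := isReducible_entries hes he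
  · refine .of_nfCheckFails h (Sym2.mem_mk_left _ _) (h.stored_le j (hL j hj)) ?_ hf
    -- The F5 criterion needs the check to be made with the elements of index above that of the
    -- candidate. This holds because a candidate from `Gprev` cannot divide the head of a polynomial
    -- irreducible modulo `Gprev`.
    refine (h.index j (hL j hj)).resolve_left fun hjp => ?_
    exact hirr _ ⟨j, hjp, rfl⟩ _ (mo.degree_mem_support h0) hle
  · exact .of_rewritten h (Sym2.mem_mk_left _ _) (h.stored_le j (hL j hj)) hr

end F5

/-! ### Degrees determined by signatures, the machine invariant, and the phases up to `Spol` -/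

namespace F5

open MvPolynomial

variable {n m : ℕ} {K : Type*} [Field K] {mo : MonomialOrder (Fin n)}
  {f : Fin m → MvPolynomial (Fin n) K} {δ : ℕ → ℕ} {D : Mem n K}
  {i : ℕ} {Gprev : List ℕ} {S T : Set ℕ}

/-! ### Degrees -/

theorem partPoly_homogeneous (h : MemOK mo f δ D) {p : Part n} (hp : p.pos ≤ D.N) :
    (D.partPoly p).IsHomogeneous ((D.partSig p).weight δ) := by
  rw [Mem.partSig, Sig.weight_mul]
  exact (isHomogeneous_monomial _ rfl).mul (h.hom _ hp)

theorem spairPart_mult_add (D : Mem n K) (a b : ℕ) :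
    (D.spairPart mo a b).mult + D.hm mo a = D.hm mo a ⊔ D.hm mo b :=
  tsub_add_cancel_of_le le_sup_left

theorem Config.hm_degree (h : Config mo f δ D i Gprev S T) {x : ℕ} (hx : x ∈ S) :
    (D.hm mo x).degree = (D.R x).sig.weight δ :=
  homogeneous_degree_head (h.mem.hom x (h.stored_le x hx)) (h.ne_zero hx)

/-- Homogeneity makes the weight of a signature the degree of its nonzero polynomial, so bounds on
signatures become bounds on the degree of the lcm. -/
theorem Config.weight_spairPart (h : Config mo f δ D i Gprev S T) {a b : ℕ} (ha : a ∈ S) :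
    (D.partSig (D.spairPart mo a b)).weight δ = (D.hm mo a ⊔ D.hm mo b).degree := by
  rw [← spairPart_mult_add, map_add, h.hm_degree ha, Mem.partSig, Sig.weight_mul]
  rfl

/-! ### The invariants of the phases -/

/-- The invariant of `Spol`. -/
structure SpolInv (mo : MonomialOrder (Fin n)) (f : Fin m → MvPolynomial (Fin n) K) (δ : ℕ → ℕ)
    (D : Mem n K) (c : Call n) (Pd : List (CritPair n)) (F : List ℕ) (d : ℕ) : Prop where
  config : Config mo f δ D c.i c.Gprev {x | x ∈ c.G} {x | x ∈ F}
  pend : Pend mo D c.i c.G (c.P ++ Pd)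
  degP : ∀ p ∈ c.P, d < p.lcm.degree
  degPd : ∀ p ∈ Pd, p.lcm.degree = d
  nodup : F.Nodup
  weight : ∀ y ∈ F, (D.R y).sig.weight δ = d
  -- Everything in `F` is newer than everything in `G`, so its rules count against multiples of
  -- elements of `G`; this is also the source of the distinct signatures in `inj`.
  lt : ∀ x ∈ c.G, ∀ y ∈ F, x < y
  inj : ∀ x ∈ F, ∀ y ∈ F, (D.R x).sig = (D.R y).sig → x = y

/-- The invariant of `Reduction`. -/
structure RedInv (mo : MonomialOrder (Fin n)) (f : Fin m → MvPolynomial (Fin n) K) (δ : ℕ → ℕ)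
    (D : Mem n K) (c : Call n) (ToDo Done : List ℕ) (d : ℕ) : Prop where
  config : Config mo f δ D c.i c.Gprev {x | x ∈ c.G ++ Done} {x | x ∈ ToDo}
  pend : Pend mo D c.i c.G c.P
  degP : ∀ p ∈ c.P, d < p.lcm.degree
  nodup : ToDo.Nodup
  weight : ∀ y ∈ ToDo, (D.R y).sig.weight δ = d
  weight_done : ∀ y ∈ Done, (D.R y).sig.weight δ = d
  index_done : ∀ y ∈ Done, (D.R y).sig.index = c.i
  lt : ∀ x ∈ c.G, ∀ y ∈ ToDo, x < y
  inj : ∀ x ∈ ToDo, ∀ y ∈ ToDo, (D.R x).sig = (D.R y).sig → x = y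
  sig_lt : ∀ x ∈ Done, ∀ y ∈ ToDo, Sig.Lt mo (D.R x).sig (D.R y).sig
  logged : ∀ a ∈ Done, ∀ b ∈ c.G ++ Done, a ≠ b → (D.hm mo a ⊔ D.hm mo b).degree = d →
    Logged mo D a b

/-- The invariant of the machine. -/
def Inv (mo : MonomialOrder (Fin n)) (f : Fin m → MvPolynomial (Fin n) K) (δ : ℕ → ℕ) :
    State n K → Prop
  | ⟨D, .finished i G⟩ => (∃ Gprev, Config mo f δ D i Gprev {x | x ∈ G} ∅) ∧
      ∀ a ∈ G, ∀ b ∈ G, a ≠ b → Logged mo D a b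
  | ⟨D, .loop c⟩ => Config mo f δ D c.i c.Gprev {x | x ∈ c.G} ∅ ∧ Pend mo D c.i c.G c.P
  | ⟨D, .spol c Pd F⟩ => ∃ d, SpolInv mo f δ D c Pd F d
  | ⟨D, .reduction c ToDo Done⟩ => ∃ d, RedInv mo f δ D c ToDo Done d
  | ⟨D, .collect c Rd⟩ => Config mo f δ D c.i c.Gprev {x | x ∈ c.G ++ Rd} ∅ ∧
      Pend mo D c.i c.G c.P ∧ ∀ x ∈ Rd, (D.R x).sig.index = c.i

/-! ### The start, and the calls of `AlgorithmF5` -/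

theorem initMem_R (mo : MonomialOrder (Fin n)) (f : Fin m → MvPolynomial (Fin n) K) {k : ℕ}
    (h1 : 1 ≤ k) (h2 : k ≤ m) :
    (initMem mo f).R k = ⟨⟨0, k⟩, monic mo (f ⟨k - 1, by omega⟩)⟩ := by
  simp [initMem, h1, h2]

theorem inv_init (hf₀ : ∀ i, f i ≠ 0)
    (hδ : ∀ k (h1 : 1 ≤ k) (h2 : k ≤ m), (f ⟨k - 1, by omega⟩).IsHomogeneous (δ k)) (hm : 1 ≤ m) :
    Inv mo f δ ⟨initMem mo f, .finished m [m]⟩ := by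
  refine ⟨⟨[], ⟨⟨le_rfl, fun _ _ => rfl, ?_, ?_, ?_, ?_⟩, le_rfl, ?_, ?_, ?_, ?_, ?_, ?_, ?_, ?_, ?_⟩⟩, ?_⟩
  · intro k hk
    rcases Nat.eq_zero_or_pos k with rfl | h0
    · simp [initMem, isHomogeneous_zero]
    · rw [initMem_R mo f h0 hk]
      simp only [Sig.weight, map_zero, zero_add]
      exact (hδ k h0 hk).C_mul _
  · simp [initMem]
  · simp [initMem]
  · intro k h1 h2
    exact absurd h1 (not_lt.mpr h2)
  · intro x hx
    simp only [List.mem_singleton, Set.mem_ofPred_eq] at hx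
    exact hx.le
  · simp
  · simp
  · intro x hx
    obtain rfl : x = m := by simpa using hx
    rw [initMem_R mo f hm le_rfl]
    exact leadingCoeff_monic (hf₀ _)
  · intro x hx
    obtain rfl : x = m := by simpa using hx
    right
    rw [initMem_R mo f hm le_rfl]
  · simp
  · intro l h1 h2
    exact absurd h1 (not_lt.mpr h2)
  · simp [initMem]
  · simp
  · intro a ha b hb hab
    simp only [List.mem_singleton] at ha hb
    omega

theorem inv_call (hf₀ : ∀ i, f i ≠ 0) {G : List ℕ} (hi : 1 ≤ i)
    (h : Inv mo f δ ⟨D, .finished (i + 1) G⟩) :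
    Inv mo f δ ⟨D.record (D.critPairs mo G i i G).1,
      .loop ⟨i, G, G ++ [i], (D.critPairs mo G i i G).2⟩⟩ := by
  obtain ⟨⟨Gprev, hc⟩, hl⟩ := h
  have him : i ≤ m := (Nat.le_succ i).trans hc.le_m
  have hRi : D.R i = _ := (hc.mem.input i him).trans (initMem_R mo f hi him)
  have hgt : ∀ x ∈ G, i < (D.R x).sig.index := fun x hx => hc.index_ge hx
  have hc' : Config mo f δ D i G {x | x ∈ G ++ [i]} ∅ := by
    refine ⟨hc.mem, him, ?_, by simp, by simp, ?_, ?_, ?_, ?_, ?_, hl⟩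
    · intro x hx
      rcases List.mem_append.mp hx with hx | hx
      · exact hc.stored_le x hx
      · rw [List.mem_singleton.mp hx]
        exact him.trans hc.mem.le_N
    · intro x hx
      rcases List.mem_append.mp hx with hx | hx
      · exact hc.lc x hx
      · rw [List.mem_singleton.mp hx, hRi]
        exact leadingCoeff_monic (hf₀ _)
    · intro x hx
      refine (List.mem_append.mp hx).imp_right fun hx => ?_
      rw [List.mem_singleton.mp hx, hRi]
    · exact fun x hx => ⟨List.mem_append_left _ hx, hgt x hx⟩
    · exact fun l h1 h2 => (hc.alive l h1 h2).imp_left fun h => List.mem_append_left _ h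
    -- No position is waiting for reduction between two calls, so the change of `Gprev` costs
    -- nothing.
    · exact hc.entries_mono (fun x hx => List.mem_append_left _ hx) (by simp)
  exact hc'.addToG (P := []) ⟨by simp, fun a ha b hb hab => .inl (hl a ha b hb hab)⟩
    (fun x hx => List.mem_append_left _ hx) (List.mem_append_right _ (List.mem_singleton.mpr rfl))
    (by rw [hRi])

theorem inv_collect {c : Call n} {L₁ L₂ : List ℕ} {k : ℕ}
    (h : Inv mo f δ ⟨D, .collect c (L₁ ++ k :: L₂)⟩) :
    Inv mo f δ ⟨D.record (D.critPairs mo c.Gprev c.i k c.G).1,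
      .collect { c with
        G := c.G ++ [k]
        P := c.P ++ (D.critPairs mo c.Gprev c.i k c.G).2 } (L₁ ++ L₂)⟩ := by
  obtain ⟨hc, hP, hidx⟩ := h
  have hk : k ∈ L₁ ++ k :: L₂ := by simp
  obtain ⟨h1, h2⟩ := hc.addToG hP (fun x hx => List.mem_append_left _ hx)
    (List.mem_append_right _ hk) (hidx k hk)
  refine ⟨?_, h2, fun x hx => hidx x ?_⟩
  · convert h1 using 1
    ext x
    simp only [Set.mem_ofPred_eq, List.mem_append, List.mem_cons, List.not_mem_nil, or_false]
    tauto
  · simp only [List.mem_append, List.mem_cons] at hx ⊢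
    tauto

/-! ### `Spol` -/

theorem inv_select {c : Call n} {d : ℕ} (hmin : ∀ p ∈ c.P, d ≤ p.lcm.degree)
    (h : Inv mo f δ ⟨D, .loop c⟩) :
    Inv mo f δ ⟨D, .spol { c with P := c.P.filter fun p => p.lcm.degree ≠ d }
      (c.P.filter fun p => p.lcm.degree = d) []⟩ := by
  obtain ⟨hc, hP⟩ := h
  refine ⟨d, ⟨by simpa using hc, ⟨?_, ?_⟩, ?_, by simp, by simp, by simp, by simp, by simp⟩⟩
  · intro cp hcp
    refine hP.1 cp ?_
    simp only [List.mem_append, List.mem_filter] at hcp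
    tauto
  · intro a ha b hb hab
    refine (hP.2 a ha b hb hab).imp_right fun ⟨cp, hcp, hs⟩ => ⟨cp, ?_, hs⟩
    by_cases hd : cp.lcm.degree = d <;> simp [hcp, hd]
  · intro p hp
    simp only [List.mem_filter, decide_eq_true_eq] at hp
    exact lt_of_le_of_ne (hmin p hp.1) (Ne.symm hp.2)

theorem Pend.remove {G : List ℕ} {A B : List (CritPair n)} {p : CritPair n}
    (h : Pend mo D i G (A ++ p :: B)) {o : Outcome n} (ho : (s(p.hi, p.lo), o) ∈ D.log) :
    Pend mo D i G (A ++ B) := by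
  refine ⟨fun cp hcp => h.1 cp ?_, fun a ha b hb hab => ?_⟩
  · simp only [List.mem_append, List.mem_cons] at hcp ⊢
    tauto
  · rcases h.2 a ha b hb hab with h' | ⟨cp, hcp, hs⟩
    · exact .inl h'
    · rcases eq_or_ne cp p with rfl | hne
      · exact .inl ⟨o, hs ▸ ho⟩
      · refine .inr ⟨cp, ?_, hs⟩
        simp only [List.mem_append, List.mem_cons] at hcp ⊢
        tauto

theorem SpolInv.congr {c : Call n} {P₁ P₂ : List (CritPair n)} {p : CritPair n} {F : List ℕ} {d : ℕ}
    (h : SpolInv mo f δ D c (P₁ ++ p :: P₂) F d) {o : Outcome n}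
    (hc : Config mo f δ (D.record [(s(p.hi, p.lo), o)]) c.i c.Gprev {x | x ∈ c.G} {x | x ∈ F}) :
    SpolInv mo f δ (D.record [(s(p.hi, p.lo), o)]) c (P₁ ++ P₂) F d where
  config := hc
  pend := by
    have h1 := h.pend.congr (D' := D.record [(s(p.hi, p.lo), o)]) (fun _ _ => rfl)
      (List.subset_append_left _ _)
    rw [← List.append_assoc] at h1 ⊢
    exact h1.remove (List.mem_append_right _ (List.mem_singleton.mpr rfl))
  degP := h.degP
  degPd q hq := h.degPd q (by simp only [List.mem_append, List.mem_cons] at hq ⊢; tauto)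
  nodup := h.nodup
  weight := h.weight
  lt := h.lt
  inj := h.inj

theorem inv_spol {c : Call n} {P₁ P₂ : List (CritPair n)} {p : CritPair n} {F : List ℕ}
    (h : Inv mo f δ ⟨D, .spol c (P₁ ++ p :: P₂) F⟩) :
    Inv mo f δ ⟨(D.spol p).1, .spol c (P₁ ++ P₂) (F ++ (D.spol p).2)⟩ := by
  obtain ⟨d, h⟩ := h
  refine ⟨d, ?_⟩
  have hc := h.config
  obtain ⟨x, hx, y, hy, rfl, hle, hidx⟩ := h.pend.1 p (by simp)
  have hxN : x ≤ D.N := hc.stored_le x hx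
  have hyN : y ≤ D.N := hc.stored_le y hy
  rw [Mem.spol]
  split_ifs with h1 h2
  · rw [List.append_nil]
    refine h.congr (hc.record fun e he => ?_)
    rw [List.mem_singleton.mp he]
    exact .of_rewritten hc (Sym2.mem_mk_left _ _) hxN h1
  · rw [List.append_nil]
    refine h.congr (hc.record fun e he => ?_)
    rw [List.mem_singleton.mp he]
    exact .of_rewritten hc (Sym2.mem_mk_right _ _) hyN h2
  · simp only
    set P := D.spairPart mo x y
    set Q := D.spairPart mo y x
    have hmP : P.mult + D.hm mo x = D.hm mo x ⊔ D.hm mo y := spairPart_mult_add D x y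
    have hmQ : Q.mult + D.hm mo y = D.hm mo x ⊔ D.hm mo y := by
      rw [sup_comm]
      exact spairPart_mult_add D y x
    have hwP : (D.partSig P).weight δ = (D.hm mo x ⊔ D.hm mo y).degree := hc.weight_spairPart hx
    have hwQ : (D.partSig Q).weight δ = (D.hm mo x ⊔ D.hm mo y).degree := by
      rw [sup_comm]
      exact hc.weight_spairPart hy
    have hd : (D.hm mo x ⊔ D.hm mo y).degree = d := h.degPd ⟨_, P, Q⟩ (by simp)
    have hc2 := hc.append (s := D.partSig P) (p := D.partPoly P - D.partPoly Q) hidx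
      ((partPoly_homogeneous hc.mem hxN).sub (by
        rw [hwP, ← hwQ]; exact partPoly_homogeneous hc.mem hyN))
    have hR : ∀ z ≤ D.N, (D.append (D.partSig P) (D.partPoly P - D.partPoly Q)).R z = D.R z :=
      fun z hz => append_of_le _ _ _ hz
    have hnew := append_new D (D.partSig P) (D.partPoly P - D.partPoly Q)
    have hF : ∀ z ∈ F, z ≤ D.N := fun z hz => (hc.todo z hz).2.1
    -- A pending element with this signature would be newer than `x`, and `Rewritten?` would have
    -- rejected the greater part.
    have hfresh : ∀ z ∈ F, (D.R z).sig ≠ D.partSig P := by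
      intro z hz hs
      refine h1 ((hc.mem.rewritten_iff hxN).mpr
        ⟨z, (hc.todo z hz).1, h.lt x hx z hz, hF z hz, ?_⟩)
      rw [hs]
      exact ⟨rfl, le_rfl⟩
    set D' := D.append (D.partSig P) (D.partPoly P - D.partPoly Q)
    have hsP : D'.partSig P = D.partSig P := partSig_congr (congrArg LabeledPoly.sig (hR x hxN))
    have hsQ : D'.partSig Q = D.partSig Q := partSig_congr (congrArg LabeledPoly.sig (hR y hyN))
    have hset : {z | z ∈ F ++ [D.N + 1]} = insert (D.N + 1) {z | z ∈ F} := by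
      ext z
      simp [or_comm]
    have hc3 : Config mo f δ (D'.record [(s(P, Q), .computed (D.N + 1))]) c.i c.Gprev
        {z | z ∈ c.G} {z | z ∈ F ++ [D.N + 1]} := by
      rw [hset]
      refine hc2.record fun e he => ?_
      rw [List.mem_singleton.mp he]
      refine ⟨P, Q, rfl, hx, Nat.lt_succ_of_le hxN, Nat.lt_succ_of_le hyN,
        Nat.lt_succ_of_le hc.mem.le_N, le_rfl, ?_, ?_, ?_⟩
      · rw [hnew, hsP]
      · rw [hsP, hsQ]
        exact hle
      · right; right
        -- Both parts are stored and hence monic, so `spoly` is the plain difference and the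
        -- reduction is still empty.
        refine ⟨?_, ⟨1, one_ne_zero, _, .refl, ?_⟩, fun hQT => ?_⟩
        · change Q.mult + D'.hm mo y = P.mult + D'.hm mo x
          rw [Mem.hm, Mem.hm, hR x hxN, hR y hyN]
          exact hmQ.trans hmP.symm
        · rw [hnew, C_1, one_mul, spoly]
          change _ = C (mo.leadingCoeff (D'.R y).poly) * (monomial P.mult 1 * (D'.R x).poly) -
            C (mo.leadingCoeff (D'.R x).poly) * (monomial Q.mult 1 * (D'.R y).poly)
          rw [hR x hxN, hR y hyN, hc.lc x hx, hc.lc y hy, C_1, one_mul, one_mul]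
          rfl
        · exact absurd hQT (hc2.disj y hy)
    refine ⟨hc3, ?_, h.degP, ?_, ?_, ?_, ?_, ?_⟩
    · have h3 := h.pend.congr (D' := D'.record [(s(P, Q), .computed (D.N + 1))])
        (fun z hz => hR z (hc.stored_le z hz)) (List.subset_append_left _ _)
      rw [← List.append_assoc] at h3 ⊢
      exact h3.remove (List.mem_append_right _ (List.mem_singleton.mpr rfl))
    · intro q hq
      refine h.degPd q ?_
      simp only [List.mem_append, List.mem_cons] at hq ⊢
      tauto
    · rw [List.nodup_append]
      refine ⟨h.nodup, List.nodup_singleton _, fun z hz w hw => ?_⟩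
      have := hF z hz
      rw [List.mem_singleton.mp hw]
      omega
    · intro z hz
      change (D'.R z).sig.weight δ = d
      rcases List.mem_append.mp hz with hz | hz
      · rw [hR z (hF z hz)]
        exact h.weight z hz
      · rw [List.mem_singleton.mp hz, hnew]
        exact hwP.trans hd
    · intro z hz w hw
      rcases List.mem_append.mp hw with hw | hw
      · exact h.lt z hz w hw
      · rw [List.mem_singleton.mp hw]
        exact Nat.lt_succ_of_le (hc.stored_le z hz)
    · intro z hz w hw
      change (D'.R z).sig = (D'.R w).sig → z = w
      rcases List.mem_append.mp hz with hz | hz <;> rcases List.mem_append.mp hw with hw | hw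
      · rw [hR z (hF z hz), hR w (hF w hw)]
        exact h.inj z hz w hw
      · rw [hR z (hF z hz), List.mem_singleton.mp hw, hnew]
        exact fun hs => absurd hs (hfresh z hz)
      · rw [hR w (hF w hw), List.mem_singleton.mp hz, hnew]
        exact fun hs => absurd hs.symm (hfresh w hw)
      · rw [List.mem_singleton.mp hz, List.mem_singleton.mp hw]
        exact fun _ => rfl

theorem inv_reduce {c : Call n} {F : List ℕ} (h : Inv mo f δ ⟨D, .spol c [] F⟩) :
    Inv mo f δ ⟨D, .reduction c F []⟩ := by
  obtain ⟨d, h⟩ := h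
  refine ⟨d, ⟨?_, ?_, h.degP, h.nodup, h.weight, by simp, by simp, h.lt, h.inj, by simp, by simp⟩⟩
  · simpa using h.config
  · simpa using h.pend

end F5

/-! ### Preservation of the invariant by `Reduction`, and its consequences for S-pairs -/

namespace F5

open MvPolynomial

variable {n m : ℕ} {K : Type*} [Field K] {mo : MonomialOrder (Fin n)}
  {f : Fin m → MvPolynomial (Fin n) K} {δ : ℕ → ℕ} {D : Mem n K}
  {c : Call n} {ToDo Done : List ℕ} {d : ℕ}

/-! ### `Reduction` -/

namespace RedInv

theorem congr (h : RedInv mo f δ D c ToDo Done d) {D' : Mem n K}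
    (hc : Config mo f δ D' c.i c.Gprev {x | x ∈ c.G ++ Done} {x | x ∈ ToDo})
    (hR : ∀ x ∈ c.G ++ Done, D'.R x = D.R x) (hsig : ∀ x ∈ ToDo, (D'.R x).sig = (D.R x).sig)
    (hlog : D.log ⊆ D'.log) : RedInv mo f δ D' c ToDo Done d where
  config := hc
  pend := h.pend.congr (fun x hx => hR x (List.mem_append_left _ hx)) hlog
  degP := h.degP
  nodup := h.nodup
  weight y hy := by
    rw [hsig y hy]
    exact h.weight y hy
  weight_done y hy := by
    rw [hR y (List.mem_append_right _ hy)]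
    exact h.weight_done y hy
  index_done y hy := by
    rw [hR y (List.mem_append_right _ hy)]
    exact h.index_done y hy
  lt := h.lt
  inj x hx y hy := by
    rw [hsig x hx, hsig y hy]
    exact h.inj x hx y hy
  sig_lt x hx y hy := by
    rw [hsig y hy, hR x (List.mem_append_right _ hx)]
    exact h.sig_lt x hx y hy
  logged a ha b hb hab hd := by
    have hRa := hR a (List.mem_append_right _ ha)
    have hRb := hR b hb
    rw [Mem.hm, Mem.hm, hRa, hRb] at hd
    exact (h.logged a ha b hb hab hd).mono hRa hRb hlog

theorem setPoly (h : RedInv mo f δ D c ToDo Done d) {k : ℕ} (hk : k ∈ ToDo)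
    {p : MvPolynomial (Fin n) K}
    (hc : Config mo f δ (D.setPoly k p) c.i c.Gprev {x | x ∈ c.G ++ Done} {x | x ∈ ToDo}) :
    RedInv mo f δ (D.setPoly k p) c ToDo Done d :=
  h.congr hc (fun x hx => setPoly_of_ne _ _ fun hxk => h.config.disj x hx (hxk ▸ hk))
    (fun _ _ => setPoly_sig _ _ _ _) (List.Subset.refl _)

/-- The polynomial that is selected is replaced by its normal form. -/
theorem normalize (h : RedInv mo f δ D c ToDo Done d) {k : ℕ} {p : MvPolynomial (Fin n) K}
    (hs : Selects mo D c ToDo k p) :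
    RedInv mo f δ (D.setPoly k p) c ToDo Done d ∧
      TermsIrreducible mo ((D.setPoly k p).polys c.Gprev) ((D.setPoly k p).R k).poly := by
  obtain ⟨hk, -, hred, hirr⟩ := hs
  have hidx := (h.config.todo k hk).2.2
  constructor
  · exact h.setPoly hk (h.config.setPoly_reduces hk (h.config.safeReduces hidx hred)
      (.inr fun hi => hi.eq_of_reduces hred))
  · rw [h.config.polys_setPoly hk, setPoly_self]
    exact hirr

/-- The selected polynomial, if nonzero, is replaced by its normal form, and the rejections in the
search for a reductor are recorded. -/
theorem search (h : RedInv mo f δ D c ToDo Done d) {k : ℕ} {p : MvPolynomial (Fin n) K}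
    (hs : Selects mo D c ToDo k p) (hp : p ≠ 0) {L : List ℕ} (hL : L.Perm (c.G ++ Done))
    {es : List (LogEntry n)} {o : Option ℕ}
    (hes : (D.setPoly k p).isReducible mo c.Gprev k L = (es, o)) :
    RedInv mo f δ ((D.setPoly k p).record es) c ToDo Done d := by
  obtain ⟨h1, hirr⟩ := h.normalize hs
  refine h1.congr (h1.config.record_isReducible ?_ hirr (fun x hx => hL.mem_iff.mp hx) hes)
    (fun _ _ => rfl) (fun _ _ => rfl) (List.subset_append_left _ _)
  rwa [setPoly_self]

theorem erase_set (h : RedInv mo f δ D c ToDo Done d) (k : ℕ) :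
    {x | x ∈ ToDo.erase k} = {x | x ∈ ToDo} \ {k} := by
  ext x
  simp [h.nodup.mem_erase_iff, and_comm]

end RedInv

theorem inv_zero {k : ℕ} (hs : Selects mo D c ToDo k 0)
    (h : Inv mo f δ ⟨D, .reduction c ToDo Done⟩) :
    Inv mo f δ ⟨D.setPoly k 0, .reduction c (ToDo.erase k) Done⟩ := by
  obtain ⟨d, h⟩ := h
  have h1 := (h.normalize hs).1
  have hsub : ∀ {x}, x ∈ ToDo.erase k → x ∈ ToDo := List.mem_of_mem_erase
  exact ⟨d, ⟨h.erase_set k ▸ h1.config.drop (setPoly_self _ _ _), h1.pend, h1.degP,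
    h1.nodup.erase k, fun y hy => h1.weight y (hsub hy), h1.weight_done, h1.index_done,
    fun x hx y hy => h1.lt x hx y (hsub hy),
    fun x hx y hy => h1.inj x (hsub hx) y (hsub hy),
    fun x hx y hy => h1.sig_lt x hx y (hsub hy), h1.logged⟩⟩

/-- When no reductor is found, the S-pairs of degree `d` of the selected polynomial and the stored
ones have been processed. -/
theorem RedInv.logged_of_isReducible (h : RedInv mo f δ D c ToDo Done d) {k : ℕ} (hk : k ∈ ToDo)
    (h0 : (D.R k).poly ≠ 0) {Gprev : List ℕ} {L : List ℕ} {es : List (LogEntry n)}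
    (hes : D.isReducible mo Gprev k L = (es, none)) (hlog : es ⊆ D.log) {b : ℕ}
    (hb : b ∈ c.G ++ Done) (hbL : b ∈ L) (hd : (D.hm mo k ⊔ D.hm mo b).degree = d) :
    Logged mo D k b := by
  have hkd : (D.hm mo k).degree = d := by
    rw [← h.weight k hk]
    exact homogeneous_degree_head (h.config.mem.hom k (h.config.todo k hk).2.1) h0
  -- The head of `r_k` divides the lcm and has the same degree `d`, so it is the lcm: the S-pair has
  -- the form examined by `IsReducible`.
  have hlcm : D.hm mo k = D.hm mo k ⊔ D.hm mo b :=
    mon_eq_of_le_of_degree_le le_sup_left (by omega)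
  have hle : D.hm mo b ≤ D.hm mo k := sup_eq_left.mp hlcm.symm
  rcases isReducible_none hes hbL hle with ⟨o, ho⟩ | ⟨hnr, hsig⟩
  · refine ⟨o, ?_⟩
    rw [Mem.spairPart, Mem.spairPart, sup_comm (D.hm mo b), ← hlcm, tsub_self, Sym2.eq_swap]
    exact hlog ho
  -- A candidate stopped by check (d). In `G` it is older than `k`, whose equal signature makes
  -- `Rewritten?` true; in `Done` its multiplier is 1 and its signature is strictly smaller than
  -- that of `r_k`.
  · exfalso
    have hkT := h.config.todo k hk
    rcases List.mem_append.mp hb with hbG | hbD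
    · refine hnr ((h.config.mem.rewritten_iff (h.config.stored_le b hb)).mpr
        ⟨k, hkT.1, h.lt b hbG k hk, hkT.2.1, ?_⟩)
      rw [hsig]
      exact ⟨rfl, le_rfl⟩
    · have hbd := h.config.hm_degree hb
      rw [h.weight_done b hbD] at hbd
      have heq : D.hm mo b = D.hm mo k := mon_eq_of_le_of_degree_le hle (by omega)
      rw [heq, tsub_self, Mem.partSig, Sig.mul_zero_left] at hsig
      have := h.sig_lt b hbD k hk
      rw [hsig] at this
      exact Sig.lt_irrefl _ this

/-- The step is split into taking the normal form, searching, scaling to a monic polynomial, and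
storing. Scaling keeps all head monomials, so the S-pairs found processed before it are those of the
stored element. -/
theorem inv_done {s s' : State n K} {k : ℕ} (hadd : AddsToDone mo s k s') (h : Inv mo f δ s) :
    Inv mo f δ s' := by
  obtain ⟨D, c, ToDo, Done, _, p, L, es, hs, hp, hL, hes⟩ := hadd
  obtain ⟨d, h⟩ := h
  have hk := hs.1
  have h2 := h.search hs hp hL hes
  have hmon : monic mo p = C (mo.leadingCoeff p)⁻¹ * (((D.setPoly k p).record es).R k).poly := by
    change _ = _ * ((D.setPoly k p).R k).poly
    rw [setPoly_self, monic]
  have hlc : (mo.leadingCoeff p)⁻¹ ≠ 0 := inv_ne_zero (mo.leadingCoeff_ne_zero_iff.mpr hp)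
  have h3 := h2.setPoly hk (h2.config.scale hk hlc)
  rw [← hmon, setPoly_record, setPoly_setPoly] at h3
  have hpk : ((D.setPoly k (monic mo p)).R k).poly = monic mo p := setPoly_self _ _ _
  have hm0 : mo.leadingCoeff (((D.setPoly k (monic mo p)).record es).R k).poly = 1 := by
    change mo.leadingCoeff ((D.setPoly k (monic mo p)).R k).poly = 1
    rw [hpk, leadingCoeff_monic hp]
  have hlogged : ∀ b ∈ c.G ++ Done,
      (((D.setPoly k (monic mo p)).record es).hm mo k ⊔
        ((D.setPoly k (monic mo p)).record es).hm mo b).degree = d →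
      Logged mo ((D.setPoly k (monic mo p)).record es) k b := by
    have hhm : ∀ x, ((D.setPoly k (monic mo p)).record es).hm mo x =
        ((D.setPoly k p).record es).hm mo x := by
      intro x
      change mo.degree ((D.setPoly k (monic mo p)).R x).poly = mo.degree ((D.setPoly k p).R x).poly
      rcases eq_or_ne x k with rfl | hx
      · rw [setPoly_self, setPoly_self, monic, degree_C_mul hlc]
      · rw [setPoly_of_ne _ _ hx, setPoly_of_ne _ _ hx]
    intro b hb hd
    rw [hhm, hhm] at hd
    -- The search never reads the log, so recording its rejections does not alter its result.
    have hes' : ((D.setPoly k p).record es).isReducible mo c.Gprev k L = (es, none) := by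
      rw [← hes]
      clear * -
      induction L with
      | nil => rfl
      | cons j L ih =>
        rw [Mem.isReducible, Mem.isReducible, ih]
        rfl
    obtain ⟨o, ho⟩ := h2.logged_of_isReducible hk
      (by change ((D.setPoly k p).R k).poly ≠ 0; rwa [setPoly_self]) hes'
      (List.subset_append_right _ _) hb (hL.mem_iff.mpr hb) hd
    refine ⟨o, ?_⟩
    rw [Mem.spairPart, Mem.spairPart, hhm, hhm]
    exact ho
  have hsub : ∀ {x}, x ∈ ToDo.erase k → x ∈ ToDo := List.mem_of_mem_erase
  have hmin : ∀ y ∈ ToDo.erase k,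
      Sig.Lt mo (((D.setPoly k (monic mo p)).record es).R k).sig
        (((D.setPoly k (monic mo p)).record es).R y).sig := by
    intro y hy
    obtain ⟨hyk, hy⟩ := (h.nodup.mem_erase_iff).mp hy
    have hsig : ∀ x, (((D.setPoly k (monic mo p)).record es).R x).sig = (D.R x).sig :=
      fun x => setPoly_sig _ _ _ _
    rw [hsig, hsig]
    exact (hs.2.1 y hy).resolve_right fun heq => hyk (h.inj k hk y hy heq).symm
  have hset : {x | x ∈ c.G ++ (Done ++ [k])} = insert k {x | x ∈ c.G ++ Done} := by
    ext x
    simp only [Set.mem_ofPred_eq, List.mem_append, List.mem_singleton, Set.mem_insert_iff]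
    tauto
  refine ⟨d, ⟨?_, h3.pend, h3.degP, h3.nodup.erase k, fun y hy => h3.weight y (hsub hy), ?_, ?_,
    fun x hx y hy => h3.lt x hx y (hsub hy), fun x hx y hy => h3.inj x (hsub hx) y (hsub hy),
    ?_, ?_⟩⟩
  · rw [hset, h.erase_set k]
    exact h3.config.store hk hm0
  · intro y hy
    rcases List.mem_append.mp hy with hy | hy
    · exact h3.weight_done y hy
    · rw [List.mem_singleton.mp hy]
      exact h3.weight k hk
  · intro y hy
    rcases List.mem_append.mp hy with hy | hy
    · exact h3.index_done y hy
    · rw [List.mem_singleton.mp hy]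
      exact (h3.config.todo k hk).2.2
  · intro x hx y hy
    rcases List.mem_append.mp hx with hx | hx
    · exact h3.sig_lt x hx y (hsub hy)
    · rw [List.mem_singleton.mp hx]
      exact hmin y hy
  · intro a ha b hb hab hd
    rw [← List.append_assoc] at hb
    rcases List.mem_append.mp ha with ha' | ha' <;> rcases List.mem_append.mp hb with hb' | hb'
    · exact h3.logged a ha' b hb' hab hd
    · obtain rfl := List.mem_singleton.mp hb'
      exact (hlogged a (List.mem_append_right _ ha') (by rwa [sup_comm])).symm
    · obtain rfl := List.mem_singleton.mp ha'
      exact hlogged b hb' hd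
    · exact absurd ((List.mem_singleton.mp ha').trans (List.mem_singleton.mp hb').symm) hab

theorem inv_safe {k : ℕ} {p : MvPolynomial (Fin n) K} {L : List ℕ} {es : List (LogEntry n)} {j : ℕ}
    (hs : Selects mo D c ToDo k p) (hp : p ≠ 0) (hL : L.Perm (c.G ++ Done))
    (hes : (D.setPoly k p).isReducible mo c.Gprev k L = (es, some j))
    (hlt : Sig.Lt mo (D.partSig ⟨mo.degree p - D.hm mo j, j⟩) (D.R k).sig)
    (h : Inv mo f δ ⟨D, .reduction c ToDo Done⟩) :
    Inv mo f δ ⟨(D.setPoly k (elim mo p (D.R j).poly (mo.degree p))).record es,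
      .reduction c ToDo Done⟩ := by
  obtain ⟨d, h⟩ := h
  refine ⟨d, ?_⟩
  have hk := hs.1
  have h2 := h.search hs hp hL hes
  obtain ⟨hjL, hle, -⟩ := isReducible_some hes
  have hj : j ∈ c.G ++ Done := hL.mem_iff.mp hjL
  have hjk : j ≠ k := fun hjk => h.config.disj j hj (hjk ▸ hk)
  have hRj : (D.setPoly k p).R j = D.R j := setPoly_of_ne _ _ hjk
  rw [Mem.hm, Mem.hm, setPoly_self, hRj] at hle
  have hRk : (((D.setPoly k p).record es).R k).poly = p := setPoly_self _ _ _
  have h3 := h2.setPoly hk (p := elim mo p (D.R j).poly (mo.degree p))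
    (h2.config.setPoly_reduces hk (.single ?_) (.inl ?_))
  · rwa [setPoly_record, setPoly_setPoly] at h3
  · rw [hRk]
    refine ⟨D.R j, ⟨j, hj, hRj⟩, mo.degree p, mo.degree_mem_support hp, hle, ?_, rfl⟩
    change Sig.Lt mo _ ((D.setPoly k p).R k).sig
    rw [setPoly_sig]
    exact hlt
  · rw [hRk]
    exact degree_elim_head (h.config.ne_zero hj) hle hp

theorem inv_fresh {k : ℕ} {p : MvPolynomial (Fin n) K} {L : List ℕ} {es : List (LogEntry n)} {j : ℕ}
    (hs : Selects mo D c ToDo k p) (hp : p ≠ 0) (hL : L.Perm (c.G ++ Done))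
    (hes : (D.setPoly k p).isReducible mo c.Gprev k L = (es, some j))
    (hnlt : ¬ Sig.Lt mo (D.partSig ⟨mo.degree p - D.hm mo j, j⟩) (D.R k).sig)
    (h : Inv mo f δ ⟨D, .reduction c ToDo Done⟩) :
    Inv mo f δ ⟨((D.setPoly k p).append (D.partSig ⟨mo.degree p - D.hm mo j, j⟩)
            (- elim mo p (D.R j).poly (mo.degree p))).record
            (es ++ [(s(⟨mo.degree p - D.hm mo j, j⟩, ⟨0, k⟩), .computed (D.N + 1))]),
          .reduction c (ToDo ++ [D.N + 1]) Done⟩ := by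
  obtain ⟨d, h⟩ := h
  refine ⟨d, ?_⟩
  have hk := hs.1
  have h1 := (h.normalize hs).1
  have h2 := h.search hs hp hL hes
  obtain ⟨hjL, hle, hnr, hne⟩ := isReducible_some hes
  have hj : j ∈ c.G ++ Done := hL.mem_iff.mp hjL
  have hjk : j ≠ k := fun hjk => h.config.disj j hj (hjk ▸ hk)
  have hirr := (h.normalize hs).2
  have hRj : (D.setPoly k p).R j = D.R j := setPoly_of_ne _ _ hjk
  have hRk : ((D.setPoly k p).R k).poly = p := setPoly_self _ _ _
  have hkN : k ≤ D.N := (h.config.todo k hk).2.1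
  have hjN : j ≤ D.N := h.config.stored_le j hj
  have hhj : (D.setPoly k p).hm mo j = D.hm mo j := by rw [Mem.hm, hRj, Mem.hm]
  have hhk : (D.setPoly k p).hm mo k = mo.degree p := by rw [Mem.hm, hRk]
  have hP1 : (D.setPoly k p).partSig ⟨mo.degree p - D.hm mo j, j⟩ =
      D.partSig ⟨mo.degree p - D.hm mo j, j⟩ := partSig_congr (setPoly_sig _ _ _ _)
  rw [hhj, hhk] at hle hnr hne
  rw [hP1, setPoly_sig] at hne
  set P : Part n := ⟨mo.degree p - D.hm mo j, j⟩ with hP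
  have hlt : Sig.Lt mo (D.R k).sig (D.partSig P) :=
    (Sig.le_of_not_lt hnlt).resolve_right (Ne.symm hne)
  have hpd : (mo.degree p).degree = d := by
    have h3 := h1.config.mem.hom k hkN
    have h4 := h1.weight k hk
    rw [h4, hRk] at h3
    exact homogeneous_degree_head h3 hp
  -- An element of `Done` has the same degree, so it would divide with multiplier 1 and be a
  -- signature-safe reductor.
  have hjG : j ∈ c.G := by
    refine (List.mem_append.mp hj).resolve_right fun hjD => ?_
    have hjd := h.config.hm_degree hj
    rw [h.weight_done j hjD] at hjd
    have heq : D.hm mo j = mo.degree p := mon_eq_of_le_of_degree_le hle (by omega)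
    refine hnlt ?_
    rw [hP, heq, tsub_self, Mem.partSig, Sig.mul_zero_left]
    exact h.sig_lt j hjD k hk
  -- A reductor from `Gprev` is impossible, since `p` is a normal form modulo `Gprev`.
  have hidx : (D.partSig P).index = c.i := by
    refine (h.config.index j hj).resolve_left fun hjp => ?_
    refine hirr _ ⟨j, hjp, rfl⟩ (mo.degree p) ?_ ?_
    · rw [hRk]
      exact mo.degree_mem_support hp
    · rw [hRj]
      exact hle
  have hwP : (D.partSig P).weight δ = d := by
    rw [Mem.partSig, Sig.weight_mul, ← h.config.hm_degree hj, ← map_add,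
      tsub_add_cancel_of_le hle, hpd]
  have hjpoly : (D.R j).poly ≠ 0 := h.config.ne_zero hj
  have helim : (- elim mo p (D.R j).poly (mo.degree p)).IsHomogeneous ((D.partSig P).weight δ) := by
    have h3 := h1.config.mem.hom k hkN
    rw [h1.weight k hk, hRk] at h3
    rw [hwP]
    exact (elim_homogeneous h3 (h.config.mem.hom j hjN) hjpoly (mo.degree_mem_support hp) hle).neg
  have hc3 := h2.config.append hidx helim
  set D₂ := (D.setPoly k p).record es with hD₂
  set q := - elim mo p (D.R j).poly (mo.degree p) with hq
  have hD₃ : ((D.setPoly k p).append (D.partSig P) q).record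
      (es ++ [(s(P, ⟨0, k⟩), .computed (D.N + 1))]) =
      (D₂.append (D.partSig P) q).record [(s(P, ⟨0, k⟩), .computed (D.N + 1))] := by
    simp [hD₂, Mem.record, Mem.append]
  rw [hD₃]
  have hR : ∀ z ≤ D.N, (D₂.append (D.partSig P) q).R z = (D.setPoly k p).R z :=
    fun z hz => append_of_le _ _ _ hz
  have hnew : (D₂.append (D.partSig P) q).R (D.N + 1) = ⟨D.partSig P, q⟩ := append_new _ _ _
  set D₃ := D₂.append (D.partSig P) q
  have hsP : D₃.partSig P = D.partSig P := partSig_congr (by rw [hR _ hjN, setPoly_sig])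
  have hT : ∀ z ∈ ToDo, z ≤ D.N := fun z hz => (h.config.todo z hz).2.1
  have hfresh : ∀ z ∈ ToDo, (D.R z).sig ≠ D.partSig P := by
    intro z hz hzs
    refine hnr ((h1.config.mem.rewritten_iff hjN).mpr
      ⟨z, (h.config.todo z hz).1, h.lt j hjG z hz, hT z hz, ?_⟩)
    rw [setPoly_sig, hzs, hP1]
    exact ⟨rfl, le_rfl⟩
  have hset : {z | z ∈ ToDo ++ [D.N + 1]} = insert (D.N + 1) {z | z ∈ ToDo} := by
    ext z
    simp [or_comm]
  have hsig : ∀ z ∈ ToDo, (D₃.R z).sig = (D.R z).sig := fun z hz => by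
    rw [hR z (hT z hz), setPoly_sig]
  have hc4 : Config mo f δ (D₃.record [(s(P, ⟨0, k⟩), .computed (D.N + 1))]) c.i c.Gprev
      {z | z ∈ c.G ++ Done} {z | z ∈ ToDo ++ [D.N + 1]} := by
    rw [hset]
    refine hc3.record fun e he => ?_
    rw [List.mem_singleton.mp he]
    refine ⟨P, ⟨0, k⟩, rfl, hj, Nat.lt_succ_of_le hjN, Nat.lt_succ_of_le hkN,
      Nat.lt_succ_of_le h.config.mem.le_N, le_rfl, ?_, ?_, ?_⟩
    · rw [hnew, hsP]
    · rw [hsP]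
      left
      rw [Mem.partSig, hsig k hk, Sig.mul_zero_left]
      exact hlt
    · right; right
      have hlcj : mo.leadingCoeff (D.R j).poly = 1 := h.config.lc j hj
      refine ⟨?_, ⟨1, one_ne_zero, _, .refl, ?_⟩, fun _ => ?_⟩
      · change 0 + D₃.hm mo k = mo.degree p - D.hm mo j + D₃.hm mo j
        have hkm : D₃.hm mo k = mo.degree p := by rw [Mem.hm, hR k hkN, hRk]
        have hjm : D₃.hm mo j = D.hm mo j := by rw [Mem.hm, hR j hjN, hRj, Mem.hm]
        rw [hkm, hjm, zero_add]
        exact (tsub_add_cancel_of_le hle).symm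
      · rw [hnew, C_1, one_mul, spoly]
        change q = C (mo.leadingCoeff (D₃.R k).poly) *
            (monomial (mo.degree p - D.hm mo j) 1 * (D₃.R j).poly) -
          C (mo.leadingCoeff (D₃.R j).poly) * (monomial 0 1 * (D₃.R k).poly)
        rw [hR k hkN, hR j hjN, hRk, hRj, hlcj, hq, elim, hlcj, div_one, ← mul_assoc,
          C_mul_monomial, mul_one, C_1, one_mul, neg_sub, Mem.hm, monomial_zero', C_1, one_mul]
        rfl
      · have hp3 : D₃.polys c.Gprev = (D.setPoly k p).polys c.Gprev := by
          ext r
          refine exists_congr fun x => and_congr_right fun hx => ?_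
          rw [hR x (h.config.stored_le x (h.config.prev x hx).1)]
        rw [hp3, hR k hkN]
        exact hirr
  have hstored : ∀ x ∈ c.G ++ Done, D₃.R x = D₂.R x := fun x hx =>
    hR x (h.config.stored_le x hx)
  refine ⟨hc4, ?_, h.degP, ?_, ?_, ?_, ?_, ?_, ?_, ?_, ?_⟩
  · exact h2.pend.congr (fun x hx => hstored x (List.mem_append_left _ hx))
      (List.subset_append_left _ _)
  · rw [List.nodup_append]
    refine ⟨h.nodup, List.nodup_singleton _, fun z hz w hw => ?_⟩
    have := hT z hz
    rw [List.mem_singleton.mp hw]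
    omega
  · intro z hz
    change (D₃.R z).sig.weight δ = d
    rcases List.mem_append.mp hz with hz | hz
    · rw [hsig z hz]
      exact h.weight z hz
    · rw [List.mem_singleton.mp hz, hnew]
      exact hwP
  · intro z hz
    change (D₃.R z).sig.weight δ = d
    rw [hstored z (List.mem_append_right _ hz)]
    exact h2.weight_done z hz
  · intro z hz
    change (D₃.R z).sig.index = c.i
    rw [hstored z (List.mem_append_right _ hz)]
    exact h2.index_done z hz
  · intro z hz w hw
    rcases List.mem_append.mp hw with hw | hw
    · exact h.lt z hz w hw
    · rw [List.mem_singleton.mp hw]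
      exact Nat.lt_succ_of_le (h.config.stored_le z (List.mem_append_left _ hz))
  · intro z hz w hw
    change (D₃.R z).sig = (D₃.R w).sig → z = w
    rcases List.mem_append.mp hz with hz | hz <;> rcases List.mem_append.mp hw with hw | hw
    · rw [hsig z hz, hsig w hw]
      exact h.inj z hz w hw
    · rw [hsig z hz, List.mem_singleton.mp hw, hnew]
      exact fun hs => absurd hs (hfresh z hz)
    · rw [hsig w hw, List.mem_singleton.mp hz, hnew]
      exact fun hs => absurd hs.symm (hfresh w hw)
    · rw [List.mem_singleton.mp hz, List.mem_singleton.mp hw]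
      exact fun _ => rfl
  · intro z hz w hw
    change Sig.Lt mo (D₃.R z).sig (D₃.R w).sig
    have hzs : (D₃.R z).sig = (D.R z).sig := by
      rw [hR z (h.config.stored_le z (List.mem_append_right _ hz)), setPoly_sig]
    rw [hzs]
    rcases List.mem_append.mp hw with hw | hw
    · rw [hsig w hw]
      exact h.sig_lt z hz w hw
    · rw [List.mem_singleton.mp hw, hnew]
      exact (h.sig_lt z hz k hk).trans hlt
  · intro a ha b hb hab hd
    have hRa := hstored a (List.mem_append_right _ ha)
    have hRb := hstored b hb
    change (mo.degree (D₃.R a).poly ⊔ mo.degree (D₃.R b).poly).degree = d at hd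
    rw [hRa, hRb] at hd
    exact (h2.logged a ha b hb hab hd).mono hRa hRb (List.subset_append_left _ _)

/-! ### Reachable states -/

theorem Step.inv (hf₀ : ∀ i, f i ≠ 0) {s s' : State n K} (hstep : Step mo s s')
    (h : Inv mo f δ s) : Inv mo f δ s' := by
  cases hstep with
  | call D i G hi => exact inv_call hf₀ hi h
  | ret D c hP =>
    obtain ⟨hc, hp⟩ := h
    rw [hP] at hp
    exact ⟨⟨_, hc⟩, hp.logged_of_nil⟩
  | select D c d _ hmin => exact inv_select hmin h
  | spol D c P₁ P₂ p F => exact inv_spol h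
  | reduce D c F => exact inv_reduce h
  | zero D c ToDo Done k hs => exact inv_zero hs h
  | done s s' k hadd => exact inv_done hadd h
  | safe D c ToDo Done k p L es j hs hp hL hes hlt => exact inv_safe hs hp hL hes hlt h
  | fresh D c ToDo Done k p L es j hs hp hL hes hlt => exact inv_fresh hs hp hL hes hlt h
  | reduced D c Done =>
    obtain ⟨d, h⟩ := h
    exact ⟨by simpa using h.config, h.pend, h.index_done⟩
  | collect D c L₁ L₂ k => exact inv_collect h
  | again D c => exact ⟨by simpa using h.1, h.2.1⟩

theorem Reachable.inv (hf₀ : ∀ i, f i ≠ 0)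
    (hδ : ∀ k (h1 : 1 ≤ k) (h2 : k ≤ m), (f ⟨k - 1, by omega⟩).IsHomogeneous (δ k))
    {s : State n K} (h : Reachable mo f s) : Inv mo f δ s := by
  obtain ⟨hm, h⟩ := h
  induction h with
  | refl => exact inv_init hf₀ hδ hm
  | tail _ hstep ih => exact hstep.inv hf₀ ih

/-! ### The result of processing an S-pair -/

theorem exists_firstOutcome {pr : Sym2 (Part n)} (h : ∃ o, (pr, o) ∈ D.log) :
    ∃ o, FirstOutcome D pr o ∧ (pr, o) ∈ D.log := by
  unfold FirstOutcome
  obtain ⟨o, ho⟩ := h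
  generalize D.log = log at ho ⊢
  induction log with
  | nil => simp at ho
  | cons e l ih =>
    by_cases he : e.1 = pr
    · obtain ⟨pr', o'⟩ := e
      obtain rfl : pr' = pr := he
      exact ⟨o', ⟨[], l, rfl, by simp⟩, List.mem_cons_self⟩
    · rcases List.mem_cons.mp ho with rfl | ho
      · exact absurd rfl he
      · obtain ⟨o', ⟨l₁, l₂, rfl, h2⟩, h3⟩ := ih ho
        refine ⟨o', ⟨e :: l₁, l₂, rfl, ?_⟩, List.mem_cons_of_mem _ h3⟩
        simpa [he] using h2

/-- Every S-pair whose signature is less than that of the selected polynomial has been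
processed. -/
theorem RedInv.logged_of_lt (hmo : IsGraded mo) (h : RedInv mo f δ D c ToDo Done d) {g a b : ℕ}
    (hg : g ∈ ToDo) (ha : a ∈ c.G ++ Done) (hb : b ∈ c.G ++ Done) (hab : a ≠ b)
    (hle : Sig.Le mo (D.partSig (D.spairPart mo b a)) (D.partSig (D.spairPart mo a b)))
    (hlt : Sig.Lt mo (D.partSig (D.spairPart mo a b)) (D.R g).sig) : Logged mo D a b := by
  have hidx : (D.R a).sig.index ≤ (D.R b).sig.index := hle.index_le
  rcases h.config.index a ha with hap | hai
  -- The part of `r_b` has the smaller signature, so its index is at least that of `r_a`, which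
  -- exceeds `c.i`; the pair belongs to an earlier call.
  · have hbp : b ∈ c.Gprev := (h.config.index b hb).resolve_right fun hbi => by
      have := (h.config.prev a hap).2
      omega
    exact h.config.logged a hap b hbp hab
  have hdeg : (D.hm mo a ⊔ D.hm mo b).degree ≤ d := by
    rw [← h.config.weight_spairPart ha, ← h.weight g hg]
    refine Sig.weight_le_of_lt hmo δ hlt ?_
    rw [(h.config.todo g hg).2.2]
    exact hai
  -- An element of `Done` already has degree `d`, so an lcm that it divides has degree at least `d`,
  -- while `hdeg` gives at most `d`.
  have hdone : ∀ x ∈ Done, D.hm mo x ≤ D.hm mo a ⊔ D.hm mo b →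
      (D.hm mo a ⊔ D.hm mo b).degree = d := by
    intro x hx hxle
    have h1 := Finsupp.degree_mono hxle
    have h2 := h.config.hm_degree (List.mem_append_right _ hx : x ∈ c.G ++ Done)
    rw [h.weight_done x hx] at h2
    omega
  rcases List.mem_append.mp ha with haG | haD
  · rcases List.mem_append.mp hb with hbG | hbD
    · refine (h.pend.2 a haG b hbG hab).resolve_right ?_
      rintro ⟨cp, hcp, hs⟩
      have h1 := (h.pend.1 cp hcp).lcm_eq hs
      have h2 := h.degP cp hcp
      rw [h1] at h2
      omega
    · have hd := hdone b hbD le_sup_right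
      rw [sup_comm] at hd
      exact (h.logged b hbD a ha hab.symm hd).symm
  · exact h.logged a haD b hb hab (hdone a haD le_sup_left)

/-- A record that the S-polynomial of two stored elements was computed as `r_l` means that it was
reduced to a constant multiple of the polynomial at position `l`. -/
theorem ComputedOK.reduced {i l a b : ℕ} {Gprev : List ℕ} {S T : Set ℕ} {P Q : Part n}
    (hc : Config mo f δ D i Gprev S T) (h : ComputedOK mo m D Gprev S T P Q l)
    (ha : a ∈ S) (hb : b ∈ S)
    (hle : Sig.Le mo (D.partSig (D.spairPart mo b a)) (D.partSig (D.spairPart mo a b)))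
    (hs : s(D.spairPart mo a b, D.spairPart mo b a) = s(P, Q)) :
    a < l ∧ (D.R l).sig = D.partSig (D.spairPart mo a b) ∧ ∃ u : K, u ≠ 0 ∧ ∃ q,
      SafeReduces mo (D.R '' S) (D.R l).sig
        (D.partPoly (D.spairPart mo a b) - D.partPoly (D.spairPart mo b a)) q ∧
      (D.R l).poly = C u * q := by
  -- For stored elements the irrelevant alternatives of the record fail: they are nonzero, and the
  -- two parts of an S-pair have the same head monomial, namely the lcm.
  have hmem : ∀ x ∈ S, ∀ y, Q = D.spairPart mo x y → P = D.spairPart mo y x → y ∈ S →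
      ReducedFrom mo D S P Q l := by
    rintro x hx y rfl rfl hy
    rcases h.poly with h0 | hlt | h0
    · exact absurd h0 (hc.ne_zero hx)
    · have h1 : (D.spairPart mo x y).mult + D.hm mo x = D.hm mo x ⊔ D.hm mo y :=
        spairPart_mult_add D x y
      have h2 : (D.spairPart mo y x).mult + D.hm mo y = D.hm mo y ⊔ D.hm mo x :=
        spairPart_mult_add D y x
      change mo.toSyn ((D.spairPart mo x y).mult + D.hm mo x) <
        mo.toSyn ((D.spairPart mo y x).mult + D.hm mo y) at hlt
      rw [h1, h2, sup_comm] at hlt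
      exact absurd hlt (lt_irrefl _)
    · exact h0.2.1
  have hspoly : ∀ x ∈ S, ∀ y ∈ S, spoly mo D (D.spairPart mo x y) (D.spairPart mo y x) =
      D.partPoly (D.spairPart mo x y) - D.partPoly (D.spairPart mo y x) := by
    intro x hx y hy
    change C (mo.leadingCoeff (D.R y).poly) * _ - C (mo.leadingCoeff (D.R x).poly) * _ = _
    rw [hc.lc x hx, hc.lc y hy, C_1, one_mul, one_mul]
  rcases Sym2.eq_iff.mp hs with ⟨rfl, rfl⟩ | ⟨rfl, rfl⟩
  · obtain ⟨u, hu, q, hq, hl⟩ := hmem b hb a rfl rfl ha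
    rw [hspoly a ha b hb] at hq
    exact ⟨h.ltP, h.sig_eq, u, hu, q, hq, hl⟩
  · obtain ⟨u, hu, q, hq, hl⟩ := hmem a ha b rfl rfl hb
    rw [hspoly b hb a ha] at hq
    -- Recorded in the opposite orientation, the two parts have equal signatures, each being at most
    -- the other, and the S-polynomial changes sign.
    refine ⟨h.ltQ, h.sig_eq.trans (hle.eq_of_le h.sig_le), -u, neg_ne_zero.mpr hu, C (-1) * q,
      ?_, ?_⟩
    · have := SafeReduces.C_mul hq (neg_ne_zero.mpr one_ne_zero)
      convert this using 1
      rw [C_neg, C_1]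
      ring
    · rw [hl, ← mul_assoc, ← C_mul]
      simp

end F5

/-! ### The theorem, read off the invariant and the first record of the S-pair -/

theorem mainTheorem6 {n m : ℕ} {K : Type*} [Field K]
    (mo : MonomialOrder (Fin n)) (hmo : F5.IsGraded mo)
    (f : Fin m → MvPolynomial (Fin n) K) (hf₀ : ∀ i, f i ≠ 0)
    (hf : ∀ i, ∃ d, (f i).IsHomogeneous d)
    -- the state just before `r_g` is added to `Done`, in the call of `AlgorithmF5` with `i = 1`
    (D : F5.Mem n K) (c : F5.Call n) (ToDo Done : List ℕ) (g : ℕ) (s' : F5.State n K)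
    (hreach : F5.Reachable mo f ⟨D, .reduction c ToDo Done⟩)
    (hadd : F5.AddsToDone mo ⟨D, .reduction c ToDo Done⟩ g s') (hc : c.i = 1)
    -- an S-pair of elements of `G_g = G₁ ∪ Done`; the part of `r_a` has the greater signature
    (a b : ℕ) (ha : a ∈ c.G ++ Done) (hb : b ∈ c.G ++ Done) (hab : a ≠ b)
    (hle : F5.Sig.Le mo (D.partSig (D.spairPart mo b a)) (D.partSig (D.spairPart mo a b)))
    (hlt : F5.Sig.Lt mo (D.partSig (D.spairPart mo a b)) (D.R g).sig) :
    -- a part was rejected by the normal form check and satisfies the F5 criterion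
    (∃ p, (p = D.spairPart mo a b ∨ p = D.spairPart mo b a) ∧
      F5.FirstOutcome D s(D.spairPart mo a b, D.spairPart mo b a) (.rejectedNF p) ∧
      F5.SatisfiesF5 mo D (c.G ++ Done) p) ∨
    -- a part was rejected by the check `Rewritten?` and satisfies the Rewritten criterion
    (∃ p, (p = D.spairPart mo a b ∨ p = D.spairPart mo b a) ∧
      F5.FirstOutcome D s(D.spairPart mo a b, D.spairPart mo b a) (.rejectedRW p) ∧
      F5.SatisfiesRewritten D p) ∨
    -- the S-polynomial was computed as `r_l`, and was reduced signature-safely to `q`; if `q ≠ 0`,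
    -- the result is in `G_g`; if `q = 0`, the greater part satisfies the Rewritten criterion
    (∃ l q, F5.FirstOutcome D s(D.spairPart mo a b, D.spairPart mo b a) (.computed l) ∧
      (D.R l).sig = D.partSig (D.spairPart mo a b) ∧
      F5.SafeReduces mo (D.labeled (c.G ++ Done)) (D.R l).sig
        (D.partPoly (D.spairPart mo a b) - D.partPoly (D.spairPart mo b a)) q ∧
      (∃ u : K, u ≠ 0 ∧ (D.R l).poly = MvPolynomial.C u * q) ∧
      (q ≠ 0 → l ∈ c.G ++ Done) ∧
      (q = 0 → F5.SatisfiesRewritten D (D.spairPart mo a b))) := by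
  choose e he using hf
  -- The degrees are extended by the arbitrary value 0 outside `1, …, m`.
  have hδ : ∀ k (h1 : 1 ≤ k) (h2 : k ≤ m), (f ⟨k - 1, by omega⟩).IsHomogeneous
      ((fun k => if h : 1 ≤ k ∧ k ≤ m then e ⟨k - 1, by omega⟩ else 0) k) := by
    intro k h1 h2
    simp only [h1, h2, and_self, dite_true]
    exact he _
  obtain ⟨d, h⟩ := hreach.inv hf₀ hδ
  obtain ⟨_, _, _, _, _, p, L, es, hs, -, -, -⟩ := hadd
  obtain ⟨o, hfirst, hmem⟩ := F5.exists_firstOutcome (h.logged_of_lt hmo hs.1 ha hb hab hle hlt)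
  have hentry := h.config.entries _ hmem
  cases o with
  | rejectedNF p =>
    obtain ⟨h1, -, k, hk, h2, h3⟩ := hentry
    refine .inl ⟨p, Sym2.mem_iff.mp h1, hfirst, (F5.nfCheckFails_iff _ _ _).mpr ⟨k, ?_, h3⟩⟩
    rw [List.mem_filter]
    exact ⟨hk, by simpa using h2⟩
  | rejectedRW p =>
    exact .inr (.inl ⟨p, Sym2.mem_iff.mp hentry.1, hfirst, hentry.2.2⟩)
  | computed l =>
    obtain ⟨P, Q, hPQ, hcomp⟩ := hentry
    obtain ⟨hal, hsig, u, hu, q, hq, hl⟩ := hcomp.reduced h.config ha hb hle hPQ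
    refine .inr (.inr ⟨l, q, hfirst, hsig, hq, ⟨u, hu, hl⟩, fun hq0 => ?_, fun _ => ?_⟩)
    · rcases h.config.alive l hcomp.lt_l hcomp.le_N with h1 | h1 | h1
      · exact h1
      · rw [← hsig] at hlt
        rcases hs.2.1 l h1 with h2 | h2
        · exact absurd (hlt.trans h2) (F5.Sig.lt_irrefl _)
        · rw [h2] at hlt
          exact absurd hlt (F5.Sig.lt_irrefl _)
      · rw [hl] at h1
        exact absurd h1 (mul_ne_zero (by simpa using hu) hq0)
    -- The vanished `r_l` itself is the later element whose signature divides that of the greater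
    -- part.
    · exact ⟨l, hal, hcomp.le_N, by rw [hsig]; exact ⟨rfl, le_rfl⟩⟩
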